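/- For $\nu\in\mathbb R$ let $S_\nu$ be the Hilbert space of all analytic functions $f(z)=\sum_{n\ge0}a_nz^n$ on the open unit disk $\mathbb D$ with $$\|f\|_\nu^2=\sum_{n=0}^\infty |a_n|^2(n+1)^{2\nu}<\infty .$$ A bounded linear operator $T$ on a Hilbert space $H$ is called recurrent if for every non-empty open set $U\subset H$ there is a positive integer $n$ with $T^n(U)\cap U\neq\emptyset$. A linear fractional map $\phi(z)=\frac{az+b}{cz+d}$, $ad-bc\ne0$, of the extended plane is called hyperbolic if it has exactly two fixed points and is conjugate, by a linear fractional map, to a dilation $w\mapsto\mu w$ with $\mu>0$; a fixed point $\eta$ of $\phi$ is attractive if the iterates of $\phi$ converge to $\eta$ at all points of some neighbourhood of $\eta$. **Theorem.** Let $\nu\in\mathbb R$, let $\phi$ be a hyperbolic linear fractional map that restricts to an automorphism of $\mathbb D$ (a bijection of $\mathbb D$ onto itself), and let $\eta$ be its attractive fixed point. Then $\phi'(\eta)$ is a real number in $(0,1)$, the composition operator $C_\phi f=f\circ\phi$ is a bounded operator on $S_\nu$, and for every $\lambda\in\mathbb C$ the operator $\lambda C_\phi$ is recurrent on $S_\nu$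 if and only if $$\nu<\tfrac12\quad\text{and}\quad \phi'(\eta)^{(1-2\nu)/2}<|\lambda|<\phi'(\eta)^{(2\nu-1)/2}.$$ -/

import Mathlib

open Complex Filter Topology Function
open scoped ComplexConjugate UnitDisc

/-- The weighted Dirichlet space with parameter `ν` as a set of functions on the open unit disk:
sums `f z = ∑ aₙ zⁿ` of power series on the disk with `∑ ‖aₙ‖ ^ 2 * (n + 1) ^ (2 * ν) < ∞`. -/
def weightedDirichletSubmodule (ν : ℝ) : Submodule ℂ (𝔻 → ℂ) where
  carrier := {f | ∃ a : ℕ → ℂ, (∀ z : 𝔻, HasSum (fun n : ℕ => a n * (z : ℂ) ^ n) (f z)) ∧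
    Summable (fun n : ℕ => ‖a n‖ ^ 2 * ((n : ℝ) + 1) ^ (2 * ν))}
  zero_mem' := ⟨0, fun z => by simp, by simp⟩
  add_mem' := by
    rintro f g ⟨a, ha, ha'⟩ ⟨b, hb, hb'⟩
    refine ⟨a + b, fun z => ?_, ?_⟩
    · simpa [add_mul] using (ha z).add (hb z)
    · refine Summable.of_nonneg_of_le (fun n => by positivity) (fun n => ?_)
        ((ha'.add hb').mul_left 2)
      have h1 : ‖(a + b) n‖ ≤ ‖a n‖ + ‖b n‖ := norm_add_le _ _
      have h2 : ‖(a + b) n‖ ^ 2 ≤ 2 * (‖a n‖ ^ 2 + ‖b n‖ ^ 2) := by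
        nlinarith [norm_nonneg ((a + b) n), sq_nonneg (‖a n‖ - ‖b n‖)]
      have h3 : (0 : ℝ) ≤ ((n : ℝ) + 1) ^ (2 * ν) := by positivity
      nlinarith [mul_le_mul_of_nonneg_right h2 h3]
  smul_mem' := by
    rintro c f ⟨a, ha, ha'⟩
    refine ⟨c • a, fun z => ?_, ?_⟩
    · simpa [mul_assoc] using (ha z).mul_left c
    · simpa [mul_pow, mul_assoc] using ha'.mul_left (‖c‖ ^ 2)

/-- The weighted Dirichlet space `S_ν`, as a type of its own (so that it carries the norm topology
and not the topology of pointwise convergence). -/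
def WeightedDirichlet (ν : ℝ) : Type := ↥(weightedDirichletSubmodule ν)

namespace WeightedDirichlet

variable {ν : ℝ}

noncomputable instance : AddCommGroup (WeightedDirichlet ν) :=
  inferInstanceAs (AddCommGroup ↥(weightedDirichletSubmodule ν))

noncomputable instance : Module ℂ (WeightedDirichlet ν) :=
  inferInstanceAs (Module ℂ ↥(weightedDirichletSubmodule ν))

/-- Elements of `S_ν` are functions on the disk. -/
instance : CoeFun (WeightedDirichlet ν) (fun _ => 𝔻 → ℂ) := ⟨Subtype.val⟩

/-- The `n`-th Taylor coefficient at `0`; see `hasSum_coeff` and `coeff_unique`. -/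
noncomputable def coeff (f : WeightedDirichlet ν) : ℕ → ℂ := Classical.choose f.2

theorem hasSum_coeff (f : WeightedDirichlet ν) (z : 𝔻) :
    HasSum (fun n : ℕ => coeff f n * (z : ℂ) ^ n) (f z) :=
  (Classical.choose_spec f.2).1 z

theorem summable_coeff (f : WeightedDirichlet ν) :
    Summable (fun n : ℕ => ‖coeff f n‖ ^ 2 * ((n : ℝ) + 1) ^ (2 * ν)) :=
  (Classical.choose_spec f.2).2

theorem coeff_unique (f : WeightedDirichlet ν) (b : ℕ → ℂ)
    (hb : ∀ z : 𝔻, HasSum (fun n : ℕ => b n * (z : ℂ) ^ n) (f z)) : b = coeff f := by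
  classical
  let F : ℂ → ℂ := fun z => if hz : ‖z‖ < 1 then f (UnitDisc.mk z hz) else 0
  have key : ∀ a : ℕ → ℂ, (∀ z : 𝔻, HasSum (fun n : ℕ => a n * (z : ℂ) ^ n) (f z)) →
      HasFPowerSeriesAt F (FormalMultilinearSeries.ofScalars ℂ a) 0 := by
    intro a ha
    rw [hasFPowerSeriesAt_iff]
    filter_upwards [Metric.ball_mem_nhds (0 : ℂ) one_pos] with z hz
    have hz' : ‖z‖ < 1 := by simpa using hz
    have := ha (UnitDisc.mk z hz')
    simpa [F, hz', FormalMultilinearSeries.coeff_ofScalars, mul_comm] using this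
  have h := (key b hb).eq_formalMultilinearSeries (key _ (hasSum_coeff f))
  ext n
  simpa [FormalMultilinearSeries.coeff_ofScalars] using
    congrArg (fun p : FormalMultilinearSeries ℂ ℂ ℂ => p.coeff n) h

theorem coe_add (f g : WeightedDirichlet ν) (z : 𝔻) : (f + g) z = f z + g z := rfl

theorem coe_smul (c : ℂ) (f : WeightedDirichlet ν) (z : 𝔻) : (c • f) z = c * f z := rfl

theorem coeff_add (f g : WeightedDirichlet ν) : coeff (f + g) = coeff f + coeff g :=
  (coeff_unique (f + g) _ fun z => by
    simpa [add_mul, coe_add] using (hasSum_coeff f z).add (hasSum_coeff g z)).symm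

theorem coeff_smul (c : ℂ) (f : WeightedDirichlet ν) : coeff (c • f) = c • coeff f :=
  (coeff_unique (c • f) _ fun z => by
    simpa [mul_assoc, coe_smul] using (hasSum_coeff f z).mul_left c).symm

theorem eq_zero_of_coeff (f : WeightedDirichlet ν) (h : ∀ n, coeff f n = 0) : f = 0 := by
  refine Subtype.ext (funext fun z => ?_)
  have := hasSum_coeff f z
  simp only [h, zero_mul] at this
  exact this.unique hasSum_zero

/-- The inner product, in Mathlib's convention (conjugate linear in the first argument). -/
noncomputable instance : Inner ℂ (WeightedDirichlet ν) :=
  ⟨fun f g => ∑' n : ℕ, conj (coeff f n) * coeff g n * (((n : ℝ) + 1) ^ (2 * ν) : ℝ)⟩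

theorem inner_def (f g : WeightedDirichlet ν) :
    inner ℂ f g = ∑' n : ℕ, conj (coeff f n) * coeff g n * (((n : ℝ) + 1) ^ (2 * ν) : ℝ) := rfl

theorem summable_inner (f g : WeightedDirichlet ν) :
    Summable (fun n : ℕ => conj (coeff f n) * coeff g n * (((n : ℝ) + 1) ^ (2 * ν) : ℝ)) := by
  refine Summable.of_norm_bounded ((summable_coeff f).add (summable_coeff g)) fun n => ?_
  have h3 : (0 : ℝ) ≤ ((n : ℝ) + 1) ^ (2 * ν) := by positivity
  rw [norm_mul, norm_mul, RCLike.norm_conj, norm_real, Real.norm_of_nonneg h3, ← add_mul]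
  refine mul_le_mul_of_nonneg_right ?_ h3
  nlinarith [sq_nonneg (‖coeff f n‖ - ‖coeff g n‖), sq_nonneg ‖coeff f n‖, sq_nonneg ‖coeff g n‖]

theorem inner_self (f : WeightedDirichlet ν) :
    inner ℂ f f = ((∑' n : ℕ, ‖coeff f n‖ ^ 2 * ((n : ℝ) + 1) ^ (2 * ν) : ℝ) : ℂ) := by
  rw [inner_def, ofReal_tsum]
  refine tsum_congr fun n => ?_
  rw [conj_mul']
  push_cast
  rfl

@[reducible]
noncomputable def innerCore (ν : ℝ) : InnerProductSpace.Core ℂ (WeightedDirichlet ν) where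
  inner f g := inner ℂ f g
  conj_inner_symm f g := by
    rw [inner_def, inner_def, conj_tsum]
    refine tsum_congr fun n => ?_
    rw [map_mul, map_mul, conj_conj, conj_ofReal, mul_comm (coeff g n)]
  re_inner_nonneg f := by
    rw [inner_self]
    exact tsum_nonneg fun n => by positivity
  add_left f g h := by
    rw [inner_def, inner_def, inner_def, ← (summable_inner f h).tsum_add (summable_inner g h)]
    refine tsum_congr fun n => ?_
    rw [coeff_add, Pi.add_apply, map_add]
    ring
  smul_left f g c := by
    rw [inner_def, inner_def, ← tsum_mul_left]
    refine tsum_congr fun n => ?_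
    rw [coeff_smul, Pi.smul_apply, smul_eq_mul, map_mul]
    ring
  definite f hf := by
    rw [inner_self, ofReal_eq_zero] at hf
    refine eq_zero_of_coeff f fun n => ?_
    have h := (hasSum_zero_iff_of_nonneg (fun n => by positivity)).1
      (hf ▸ (summable_coeff f).hasSum)
    have hn := congrFun h n
    have h3 : ((n : ℝ) + 1) ^ (2 * ν) ≠ 0 := by positivity
    simpa [h3] using hn

noncomputable instance : NormedAddCommGroup (WeightedDirichlet ν) :=
  (innerCore ν).toNormedAddCommGroup

noncomputable instance : InnerProductSpace ℂ (WeightedDirichlet ν) :=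
  InnerProductSpace.ofCore (innerCore ν).toCore

theorem norm_sq_eq (f : WeightedDirichlet ν) :
    ‖f‖ ^ 2 = ∑' n : ℕ, ‖coeff f n‖ ^ 2 * ((n : ℝ) + 1) ^ (2 * ν) := by
  rw [@norm_sq_eq_re_inner ℂ]
  change (inner ℂ f f : ℂ).re = _
  rw [inner_self, ofReal_re]

theorem rpow_two_mul_eq (ν : ℝ) (n : ℕ) :
    ((n : ℝ) + 1) ^ (2 * ν) = (((n : ℝ) + 1) ^ ν) ^ 2 := by
  rw [mul_comm, Real.rpow_mul (by positivity)]
  norm_cast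

/-- Every sequence with finite weighted norm is the Taylor coefficient sequence of an element. -/
theorem exists_coeff_eq (a : ℕ → ℂ)
    (ha : Summable (fun n : ℕ => ‖a n‖ ^ 2 * ((n : ℝ) + 1) ^ (2 * ν))) :
    ∃ f : WeightedDirichlet ν, coeff f = a := by
  have hs : ∀ z : 𝔻, Summable (fun n : ℕ => a n * (z : ℂ) ^ n) := by
    intro z
    obtain ⟨k, hk⟩ := exists_nat_ge (2 * (-ν))
    have hz : ‖(z : ℂ)‖ ^ 2 < 1 := z.sq_norm_lt_one
    have h0 : Summable (fun n : ℕ => ((n : ℝ) + 1) ^ k * (‖(z : ℂ)‖ ^ 2) ^ n) := by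
      have h1 : Summable (fun n : ℕ => (2 : ℝ) ^ k * ((n : ℝ) ^ k * (‖(z : ℂ)‖ ^ 2) ^ n)) := by
        refine Summable.mul_left _ (summable_pow_mul_geometric_of_norm_lt_one k ?_)
        rwa [Real.norm_of_nonneg (by positivity)]
      have h2 : Summable (fun n : ℕ => (‖(z : ℂ)‖ ^ 2) ^ n) :=
        summable_geometric_of_lt_one (by positivity) hz
      refine Summable.of_nonneg_of_le (fun n => by positivity) (fun n => ?_) (h1.add h2)
      have hp : (0 : ℝ) ≤ (‖(z : ℂ)‖ ^ 2) ^ n := by positivity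
      rcases Nat.eq_zero_or_pos n with rfl | hn
      · simp only [Nat.cast_zero, zero_add, one_pow, pow_zero, mul_one]
        exact le_add_of_nonneg_left (by positivity)
      · have hn' : (1 : ℝ) ≤ n := by exact_mod_cast hn
        have h3 : ((n : ℝ) + 1) ^ k ≤ 2 ^ k * (n : ℝ) ^ k := by
          rw [← mul_pow]
          exact pow_le_pow_left₀ (by positivity) (by linarith) k
        nlinarith [mul_le_mul_of_nonneg_right h3 hp]
    refine Summable.of_norm_bounded (ha.add h0) fun n => ?_
    have hw : (0 : ℝ) < ((n : ℝ) + 1) ^ ν := by positivity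
    have h4 : (((n : ℝ) + 1) ^ (-ν)) ^ 2 ≤ ((n : ℝ) + 1) ^ k := by
      rw [← rpow_two_mul_eq, ← Real.rpow_natCast]
      exact Real.rpow_le_rpow_of_exponent_le (by linarith [n.cast_nonneg (α := ℝ)]) hk
    have h5 : ‖a n * (z : ℂ) ^ n‖ =
        (‖a n‖ * ((n : ℝ) + 1) ^ ν) * (((n : ℝ) + 1) ^ (-ν) * ‖(z : ℂ)‖ ^ n) := by
      rw [norm_mul, norm_pow, Real.rpow_neg (by positivity)]
      field_simp
    have h6 : (((n : ℝ) + 1) ^ (-ν)) ^ 2 * (‖(z : ℂ)‖ ^ 2) ^ n ≤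
        ((n : ℝ) + 1) ^ k * (‖(z : ℂ)‖ ^ 2) ^ n :=
      mul_le_mul_of_nonneg_right h4 (by positivity)
    rw [h5, rpow_two_mul_eq]
    refine le_trans ?_ (add_le_add_right h6 _)
    have h7 : (((n : ℝ) + 1) ^ (-ν)) ^ 2 * (‖(z : ℂ)‖ ^ 2) ^ n =
        (((n : ℝ) + 1) ^ (-ν) * ‖(z : ℂ)‖ ^ n) ^ 2 := by ring
    rw [h7]
    nlinarith [two_mul_le_add_sq (‖a n‖ * ((n : ℝ) + 1) ^ ν)
      (((n : ℝ) + 1) ^ (-ν) * ‖(z : ℂ)‖ ^ n), sq_nonneg (‖a n‖ * ((n : ℝ) + 1) ^ ν),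
      sq_nonneg (((n : ℝ) + 1) ^ (-ν) * ‖(z : ℂ)‖ ^ n)]
  let f : WeightedDirichlet ν :=
    ⟨fun z => ∑' n : ℕ, a n * (z : ℂ) ^ n, a, fun z => (hs z).hasSum, ha⟩
  exact ⟨f, (coeff_unique f a fun z => (hs z).hasSum).symm⟩

theorem memlp_coeff (f : WeightedDirichlet ν) :
    Memℓp (fun n : ℕ => coeff f n * (((n : ℝ) + 1) ^ ν : ℝ)) 2 := by
  refine memℓp_gen ?_
  refine (summable_coeff f).congr fun n => ?_
  have h3 : (0 : ℝ) ≤ ((n : ℝ) + 1) ^ ν := by positivity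
  rw [norm_mul, norm_real, Real.norm_of_nonneg h3, rpow_two_mul_eq, ENNReal.toReal_ofNat,
    Real.rpow_two, mul_pow]

/-- The isometry `f ↦ (aₙ (n + 1) ^ ν)` of `S_ν` onto `ℓ²`. -/
noncomputable def toL2 (ν : ℝ) : WeightedDirichlet ν →ₗᵢ[ℂ] lp (fun _ : ℕ => ℂ) 2 where
  toFun f := ⟨fun n => coeff f n * (((n : ℝ) + 1) ^ ν : ℝ), memlp_coeff f⟩
  map_add' f g := by
    ext n
    change coeff (f + g) n * _ = coeff f n * _ + coeff g n * _
    rw [coeff_add, Pi.add_apply, add_mul]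
  map_smul' c f := by
    ext n
    simp [coeff_smul, mul_assoc]
  norm_map' f := by
    rw [← sq_eq_sq₀ (norm_nonneg _) (norm_nonneg _), norm_sq_eq]
    have h := lp.norm_rpow_eq_tsum (p := 2) (by norm_num)
      (⟨_, memlp_coeff f⟩ : lp (fun _ : ℕ => ℂ) 2)
    simp only [ENNReal.toReal_ofNat, Real.rpow_two] at h
    refine h.trans (tsum_congr fun n => ?_)
    have h3 : (0 : ℝ) ≤ ((n : ℝ) + 1) ^ ν := by positivity
    rw [norm_mul, norm_real, Real.norm_of_nonneg h3, rpow_two_mul_eq, mul_pow]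

theorem toL2_surjective : Surjective (toL2 ν) := by
  intro x
  have hw : ∀ n : ℕ, ((((n : ℝ) + 1) ^ ν : ℝ) : ℂ) ≠ 0 := fun n => by
    rw [ofReal_ne_zero]
    positivity
  obtain ⟨f, hf⟩ := exists_coeff_eq (ν := ν)
    (fun n => x n / (((n : ℝ) + 1) ^ ν : ℝ)) (by
      have h := (lp.memℓp x).summable (by norm_num)
      refine h.congr fun n => ?_
      have h3 : (0 : ℝ) < ((n : ℝ) + 1) ^ ν := by positivity
      rw [norm_div, norm_real, Real.norm_of_nonneg h3.le, rpow_two_mul_eq, ENNReal.toReal_ofNat,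
        Real.rpow_two]
      field_simp)
  refine ⟨f, ?_⟩
  ext n
  change coeff f n * (((n : ℝ) + 1) ^ ν : ℝ) = x n
  rw [hf]
  exact div_mul_cancel₀ _ (hw n)

instance : CompleteSpace (WeightedDirichlet ν) := by
  have h := (toL2 ν).isometry.isUniformInducing.completeSpace_congr toL2_surjective
  exact h.2 inferInstance

end WeightedDirichlet

/-- A bounded operator `T` on a Hilbert space is recurrent if every non-empty open set `U` meets `T ^ n (U)` for some
positive integer `n`. -/
def IsRecurrent {H : Type*} [NormedAddCommGroup H] [InnerProductSpace ℂ H]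
    [CompleteSpace H] (T : H →L[ℂ] H) : Prop :=
  ∀ U : Set H, IsOpen U → U.Nonempty → ∃ n : ℕ, 0 < n ∧ (((T ^ n) '' U) ∩ U).Nonempty

/-- The bounded operator `C` on `S_ν` is the composition operator `f ↦ f ∘ φ`. -/
def IsCompositionOperator {ν : ℝ} (φ : 𝔻 → 𝔻)
    (C : WeightedDirichlet ν →L[ℂ] WeightedDirichlet ν) : Prop :=
  ∀ (f : WeightedDirichlet ν) (z : 𝔻), C f z = f (φ z)

/-- The linear fractional map `z ↦ (a z + b) / (c z + d)` of a matrix, on the complex plane.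
The action of `GL (Fin 2) ℂ` on `OnePoint ℂ` is its extension to the extended plane. -/
noncomputable def linearFractional (g : GL (Fin 2) ℂ) (z : ℂ) : ℂ :=
  (g 0 0 * z + g 0 1) / (g 1 0 * z + g 1 1)

/-- The self-map `φ` of the disk is the restriction of the linear fractional map `g`, and it is an
automorphism of the disk. -/
def IsLinearFractionalAutomorphism (g : GL (Fin 2) ℂ) (φ : 𝔻 → 𝔻) : Prop :=
  (∀ z : 𝔻, g • ((z : ℂ) : OnePoint ℂ) = ((φ z : ℂ) : OnePoint ℂ)) ∧ Bijective φ

/-- A linear fractional map is hyperbolic if it has exactly two fixed points in the extended plane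
and is conjugate to a dilation `w ↦ μ w` (fixing `∞`) with `μ > 0`. -/
def IsHyperbolicLF (g : GL (Fin 2) ℂ) : Prop :=
  {z : OnePoint ℂ | g • z = z}.ncard = 2 ∧
  ∃ (T : GL (Fin 2) ℂ) (μ : ℝ), 0 < μ ∧
    ∀ z : OnePoint ℂ, g • z = T⁻¹ • OnePoint.map (fun w : ℂ => (μ : ℂ) * w) (T • z)

/-- `η` is a fixed point of `g`, and the iterates of `g` at all points near `η` converge to `η`. -/
def IsAttractiveFixedPoint (g : GL (Fin 2) ℂ) (η : OnePoint ℂ) : Prop :=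
  g • η = η ∧ ∀ᶠ z in 𝓝 η, Tendsto (fun n : ℕ => (g ^ n) • z) atTop (𝓝 η)

/-! A hyperbolic automorphism of the disk has its fixed points η (attractive) and ζ on the unit
circle, and in the coordinate (z - η) / (z - ζ) it is multiplication by μ = φ'(η) in (0, 1). So
φ^[n] has multiplier q = μ ^ n, the inverse has the same form with η and ζ exchanged, and the
estimates on iterates become estimates in q (`exists_hasMultiplier`, `HasMultiplier`).

Boundedness: up to rotations φ is z ↦ (z + r) / (1 + r z). As r varies, the Taylor coefficients of
(1 + r z)⁻¹ f(φ z) obey a linear equation whose matrix, up to the factor 1 / (1 - r ^ 2), is a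
skew-symmetric tridiagonal matrix plus a scalar. The weight (n + 1) ^ (2ν) varies slowly, so the
weighted norm satisfies a Gronwall inequality (`exists_energy_bound`). Multiplying by 1 + r z then
gives C_φ.

Sufficiency: the powers (z - η) ^ (k + 1) with k ≥ -ν decay like q ^ (1/2 - ν) under the iterates of
C_φ (`exists_norm_pow_apply_le`), and for ν ≤ 1/2 the multiples of a fixed power of z - η are dense,
because z - η has dense range. The same holds for the inverse at ζ. In the stated range of |λ| both
λ C_φ and its inverse therefore have orbits tending to zero on dense sets, which gives recurrence
(`isRecurrent_of_dense`).

Necessity: let γ = max(0, 1/2 - ν). If |d| ≤ μ ^ γ, no f, h in a small ball about the function z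
satisfy f = d ^ n h ∘ φ^[n] with n ≥ 1. Indeed f'(0) is near 1, while |(φ^[n])'(0)| = 1 - |φ^[n](0)|
^ 2 stays away from 1, and the growth of the derivative functional at the boundary is absorbed by
|d| ^ n (`exists_open_of_norm_le`). Applied to φ with λ and to its inverse with λ⁻¹, this gives μ ^
γ < |λ| < μ ^ (-γ), which is impossible when ν ≥ 1/2. -/

/-! ### Fixed points, multiplier and derivative of a hyperbolic automorphism. -/

/-- The conjugacy relation `(w - η) / (w - ζ) = q (z - η) / (z - ζ)` with `w = φ z`, cleared of
denominators. -/
def HasMultiplier (η ζ : ℂ) (q : ℝ) (φ : 𝔻 → 𝔻) : Prop :=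
  ∀ z : 𝔻, ((φ z : ℂ) - η) * (z - ζ) = q * ((z - η) * (φ z - ζ))

theorem UnitDisc.sub_ne_zero_of_norm_eq_one {ζ : ℂ} (hζ : ‖ζ‖ = 1) (z : 𝔻) : (z : ℂ) - ζ ≠ 0 := by
  intro h
  have := z.norm_lt_one
  rw [sub_eq_zero.1 h, hζ] at this
  exact lt_irrefl _ this

namespace HasMultiplier

variable {η ζ : ℂ} {q : ℝ} {φ : 𝔻 → 𝔻}

theorem iterate (hζ : ‖ζ‖ = 1) (h : HasMultiplier η ζ q φ) (n : ℕ) :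
    HasMultiplier η ζ (q ^ n) φ^[n] := by
  induction n with
  | zero => intro z; simp
  | succ n ih =>
    intro z
    rw [iterate_succ_apply']
    have h1 := h (φ^[n] z)
    have h2 := ih z
    have h3 := UnitDisc.sub_ne_zero_of_norm_eq_one hζ (φ^[n] z)
    refine mul_left_cancel₀ h3 ?_
    push_cast at h2 ⊢
    linear_combination ((z : ℂ) - ζ) * h1 + (q : ℂ) * ((φ (φ^[n] z) : ℂ) - ζ) * h2

theorem symm {ψ : 𝔻 → 𝔻} (h : HasMultiplier η ζ q φ) (hr : ∀ z, φ (ψ z) = z) :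
    HasMultiplier ζ η q ψ := by
  intro z
  have := h (ψ z)
  rw [hr] at this
  linear_combination this

end HasMultiplier

/-- The coordinate (α z + β) / (γ z + δ) is contracted by μ, so orbits in the disk converge to the
zero η of the first form, which thus lies in the closed disk. If η were inside, the image of an
exterior point x under a high iterate of the linear fractional map would also be inside.
Surjectivity of φ and injectivity of the linear fractional map would then put x in the disk. -/
theorem exists_fixed_of_linear_forms {φ ψ : 𝔻 → 𝔻} (hr : ∀ z, φ (ψ z) = z)
    {α β γ δ : ℂ} (hdet : α * δ - β * γ ≠ 0) {μ : ℝ} (h0 : 0 < μ) (h1 : μ < 1)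
    (h : ∀ z : 𝔻, ∃ k : ℂ, α * φ z + β = k * (μ * (α * z + β)) ∧ γ * φ z + δ = k * (γ * z + δ)) :
    ∃ η : ℂ, ‖η‖ = 1 ∧ α * η + β = 0 := by
  have hit : ∀ (n : ℕ) (z : 𝔻), ∃ k : ℂ, α * φ^[n] z + β = k * ((μ : ℂ) ^ n * (α * z + β)) ∧
      γ * φ^[n] z + δ = k * (γ * z + δ) := by
    intro n z
    induction n with
    | zero => exact ⟨1, by simp, by simp⟩
    | succ n ih =>
      obtain ⟨k, hk1, hk2⟩ := ih
      obtain ⟨l, hl1, hl2⟩ := h (φ^[n] z)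
      refine ⟨l * k, ?_, ?_⟩
      · rw [iterate_succ_apply', hl1, hk1]; ring
      · rw [iterate_succ_apply', hl2, hk2]; ring
  have hμn : Tendsto (fun n : ℕ => (μ : ℂ) ^ n) atTop (𝓝 0) :=
    tendsto_pow_atTop_nhds_zero_of_norm_lt_one (by rwa [norm_real, Real.norm_of_nonneg h0.le])
  -- a point where the second form does not vanish
  obtain ⟨z, hz⟩ : ∃ z : 𝔻, γ * z + δ ≠ 0 := by
    by_contra! hc
    have e1 := hc 0
    have e2 := hc (UnitDisc.mk (1 / 2) (by norm_num))
    simp only [UnitDisc.coe_zero, UnitDisc.coe_mk] at e1 e2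
    exact hdet (by linear_combination α * e1 - β * (2 * e2 - 2 * e1))
  have hN : Tendsto (fun n : ℕ => α * (φ^[n] z : ℂ) + β) atTop (𝓝 0) := by
    have hb : ∀ n : ℕ, ‖(γ * (φ^[n] z : ℂ) + δ) * (α * z + β) / (γ * z + δ)‖ ≤
        (‖γ‖ + ‖δ‖) * ‖(α * z + β) / (γ * z + δ)‖ := by
      intro n
      rw [mul_div_assoc, norm_mul]
      gcongr
      refine (norm_add_le _ _).trans ?_
      rw [norm_mul]
      gcongr
      exact mul_le_of_le_one_right (norm_nonneg _) (φ^[n] z).norm_lt_one.le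
    have := hμn.zero_mul_isBoundedUnder_le (isBoundedUnder_of ⟨_, hb⟩)
    refine this.congr fun n => ?_
    obtain ⟨k, hk1, hk2⟩ := hit n z
    rw [hk1, hk2]
    field_simp
  have hα : α ≠ 0 := by
    rintro rfl
    have hb : β = 0 := by simpa using hN
    exact hdet (by rw [hb]; ring)
  have hη : α * (-β / α) + β = 0 := by field_simp; ring
  set η := -β / α with hηdef
  refine ⟨η, le_antisymm ?_ ?_, hη⟩
  · have h2 : Tendsto (fun n : ℕ => (φ^[n] z : ℂ)) atTop (𝓝 η) := by
      have := (hN.sub_const β).div_const α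
      simp only [zero_sub] at this
      refine this.congr fun n => ?_
      field_simp
      ring
    exact le_of_tendsto h2.norm (Eventually.of_forall fun n => (φ^[n] z).norm_lt_one.le)
  · by_contra! hlt
    obtain ⟨x, hx1, hx⟩ : ∃ x : ℂ, 1 < ‖x‖ ∧ γ * x + δ ≠ 0 := by
      by_contra! hc
      have e1 := hc 2 (by norm_num)
      have e2 := hc 3 (by norm_num)
      exact hdet (by linear_combination α * (3 * e1 - 2 * e2) - β * (e2 - e1))
    have hs : Tendsto (fun n : ℕ => (μ : ℂ) ^ n * ((α * x + β) / (γ * x + δ))) atTop (𝓝 0) := by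
      simpa using hμn.mul_const ((α * x + β) / (γ * x + δ))
    have hden : Tendsto (fun n : ℕ => α - (μ : ℂ) ^ n * ((α * x + β) / (γ * x + δ)) * γ)
        atTop (𝓝 α) := by
      simpa using tendsto_const_nhds.sub (hs.mul_const γ)
    -- This is the n-th image of x, obtained by solving the conjugacy relation for the image point.
    have hy : Tendsto (fun n : ℕ => ((μ : ℂ) ^ n * ((α * x + β) / (γ * x + δ)) * δ - β) /
        (α - (μ : ℂ) ^ n * ((α * x + β) / (γ * x + δ)) * γ)) atTop (𝓝 η) := by
      have := ((hs.mul_const δ).sub_const β).div hden hα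
      rwa [zero_mul, zero_sub] at this
    obtain ⟨n, hn1, hn2⟩ := ((hy.norm.eventually (gt_mem_nhds hlt)).and
      (hden.eventually_ne hα)).exists
    set y := ((μ : ℂ) ^ n * ((α * x + β) / (γ * x + δ)) * δ - β) /
        (α - (μ : ℂ) ^ n * ((α * x + β) / (γ * x + δ)) * γ) with hydef
    have hyeq : (α * y + β) * (γ * x + δ) = (μ : ℂ) ^ n * ((α * x + β) * (γ * y + δ)) := by
      have e1 : y * (α - (μ : ℂ) ^ n * ((α * x + β) / (γ * x + δ)) * γ) =
          (μ : ℂ) ^ n * ((α * x + β) / (γ * x + δ)) * δ - β := by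
        rw [hydef]; exact div_mul_cancel₀ _ hn2
      have e2 : (α * x + β) / (γ * x + δ) * (γ * x + δ) = α * x + β := div_mul_cancel₀ _ hx
      linear_combination (γ * x + δ) * e1 + (μ : ℂ) ^ n * (γ * y + δ) * e2
    have hrn : ∀ w, φ^[n] (ψ^[n] w) = w := (LeftInverse.iterate hr n)
    obtain ⟨k, hk1, hk2⟩ := hit n (ψ^[n] (UnitDisc.mk y hn1))
    rw [hrn, UnitDisc.coe_mk] at hk1 hk2
    set x' : ℂ := (ψ^[n] (UnitDisc.mk y hn1) : ℂ) with hx'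
    have hk : k ≠ 0 := by
      rintro rfl
      rw [zero_mul] at hk1 hk2
      exact hdet (by linear_combination α * hk2 - γ * hk1)
    rw [hk1, hk2] at hyeq
    have hμ0 : (μ : ℂ) ^ n ≠ 0 := pow_ne_zero _ (by exact_mod_cast h0.ne')
    have h3 : (α * x' + β) * (γ * x + δ) = (α * x + β) * (γ * x' + δ) :=
      mul_left_cancel₀ (mul_ne_zero hk hμ0) (by linear_combination hyeq)
    have h4 : x' = x := by
      refine mul_left_cancel₀ hdet ?_
      linear_combination h3
    have h5 : ‖x'‖ < 1 := (ψ^[n] (UnitDisc.mk y hn1)).norm_lt_one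
    rw [h4] at h5
    exact lt_asymm h5 hx1

/-- Homogeneous coordinates with a common factor k make the conjugacy meaningful also when T sends a
point to ∞. -/
theorem exists_factor_of_smul_eq (T : GL (Fin 2) ℂ) (x y : ℂ) {m : ℂ} (hm : m ≠ 0)
    (h : T • (y : OnePoint ℂ) = OnePoint.map (fun w : ℂ => m * w) (T • (x : OnePoint ℂ))) :
    ∃ k : ℂ, T 0 0 * y + T 0 1 = k * (m * (T 0 0 * x + T 0 1)) ∧
      T 1 0 * y + T 1 1 = k * (T 1 0 * x + T 1 1) := by
  have hdet : T 0 0 * T 1 1 - T 0 1 * T 1 0 ≠ 0 := by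
    have := T.det_ne_zero
    rwa [Matrix.det_fin_two] at this
  rw [OnePoint.smul_some_eq_ite, OnePoint.smul_some_eq_ite] at h
  by_cases hx : T 1 0 * x + T 1 1 = 0
  · have hy : T 1 0 * y + T 1 1 = 0 := by
      by_contra hy
      rw [if_pos hx, if_neg hy, OnePoint.map_infty] at h
      exact OnePoint.coe_ne_infty _ h
    have hN : T 0 0 * x + T 0 1 ≠ 0 := fun hN =>
      hdet (by linear_combination T 0 0 * hx - T 1 0 * hN)
    refine ⟨(T 0 0 * y + T 0 1) / (m * (T 0 0 * x + T 0 1)), ?_, ?_⟩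
    · rw [div_mul_cancel₀ _ (mul_ne_zero hm hN)]
    · rw [hx, hy, mul_zero]
  · have hy : T 1 0 * y + T 1 1 ≠ 0 := by
      intro hy
      rw [if_neg hx, if_pos hy, OnePoint.map_some] at h
      exact OnePoint.infty_ne_coe _ h
    rw [if_neg hx, if_neg hy, OnePoint.map_some, OnePoint.coe_eq_coe] at h
    refine ⟨(T 1 0 * y + T 1 1) / (T 1 0 * x + T 1 1), ?_, ?_⟩
    · rw [div_eq_iff hy] at h
      rw [h]
      ring
    · rw [div_mul_cancel₀ _ hx]

/-- Follow a point x ≠ η near η in the coordinate (α z + β) / (γ z + δ): its orbit there is μ ^ n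
times a nonzero number and must tend to 0. -/
theorem lt_one_of_isAttractiveFixedPoint {g : GL (Fin 2) ℂ} {η : ℂ}
    (hη : IsAttractiveFixedPoint g (η : OnePoint ℂ)) {α β γ δ : ℂ} (hdet : α * δ - β * γ ≠ 0)
    {μ : ℝ} (h0 : 0 < μ) (hN : α * η + β = 0)
    (h : ∀ (n : ℕ) (x y : ℂ), g ^ n • (x : OnePoint ℂ) = (y : OnePoint ℂ) →
      ∃ k : ℂ, α * y + β = k * ((μ : ℂ) ^ n * (α * x + β)) ∧ γ * y + δ = k * (γ * x + δ)) :
    μ < 1 := by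
  have hα : α ≠ 0 := by
    rintro rfl
    exact hdet (by linear_combination (-γ) * hN)
  have hD : γ * η + δ ≠ 0 := fun hD => hdet (by linear_combination α * hD - γ * hN)
  have h1 := hη.2
  rw [OnePoint.nhds_coe_eq, eventually_map] at h1
  have h2 : ∀ᶠ z in 𝓝 η, γ * z + δ ≠ 0 :=
    (by fun_prop : Continuous fun z : ℂ => γ * z + δ).continuousAt.eventually_ne hD
  obtain ⟨x, ⟨hx1, hx2⟩, hx3⟩ :=
    (((h1.and h2).filter_mono nhdsWithin_le_nhds).and
      (self_mem_nhdsWithin (a := η) (s := {η}ᶜ))).exists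
  rw [← OnePoint.nhds_coe_eq] at hx1
  have hNx : α * x + β ≠ 0 := fun e =>
    hx3 (mul_left_cancel₀ hα (by linear_combination e - hN))
  -- The value 0 at ∞ is immaterial: the orbit of x is eventually finite.
  let F : OnePoint ℂ → ℂ := fun z => z.elim 0 (fun w => (α * w + β) / (γ * w + δ))
  have hF : Tendsto F (𝓝 (η : OnePoint ℂ)) (𝓝 0) := by
    rw [OnePoint.nhds_coe_eq, tendsto_map'_iff]
    have : ContinuousAt (fun w : ℂ => (α * w + β) / (γ * w + δ)) η :=
      ContinuousAt.div (by fun_prop) (by fun_prop) hD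
    have h3 := this.tendsto
    rw [hN, zero_div] at h3
    exact h3
  have h4 := hF.comp hx1
  have hfin : ∀ᶠ n : ℕ in atTop, g ^ n • (x : OnePoint ℂ) ∈ Set.range ((↑) : ℂ → OnePoint ℂ) :=
    hx1.eventually_mem (by rw [OnePoint.nhds_coe_eq]; exact range_mem_map)
  have h5 : Tendsto (fun n : ℕ => (μ : ℂ) ^ n * ((α * x + β) / (γ * x + δ))) atTop (𝓝 0) := by
    refine h4.congr' ?_
    filter_upwards [hfin] with n hn
    obtain ⟨y, hy⟩ := hn
    obtain ⟨k, hk1, hk2⟩ := h n x y hy.symm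
    have hk : k ≠ 0 := by
      rintro rfl
      rw [zero_mul] at hk1 hk2
      exact hdet (by linear_combination α * hk2 - γ * hk1)
    change F (g ^ n • (x : OnePoint ℂ)) = _
    rw [← hy]
    change (α * y + β) / (γ * y + δ) = _
    rw [hk1, hk2]
    field_simp
  have h6 : Tendsto (fun n : ℕ => (μ : ℂ) ^ n) atTop (𝓝 0) := by
    have h7 : (α * x + β) / (γ * x + δ) ≠ 0 := div_ne_zero hNx hx2
    have := h5.mul_const ((α * x + β) / (γ * x + δ))⁻¹
    rw [zero_mul] at this
    exact this.congr fun n => mul_inv_cancel_right₀ h7 _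
  have := tendsto_pow_atTop_nhds_zero_iff_norm_lt_one.1 h6
  rwa [norm_real, Real.norm_of_nonneg h0.le] at this

theorem exists_linear_forms (g : GL (Fin 2) ℂ) (hhyp : IsHyperbolicLF g)
    (η : ℂ) (hη : IsAttractiveFixedPoint g (η : OnePoint ℂ)) :
    ∃ (α β γ δ : ℂ) (μ : ℝ), α * δ - β * γ ≠ 0 ∧ 0 < μ ∧ μ < 1 ∧ α * η + β = 0 ∧
      ∀ x y : ℂ, g • (x : OnePoint ℂ) = (y : OnePoint ℂ) →
        ∃ k : ℂ, α * y + β = k * (μ * (α * x + β)) ∧ γ * y + δ = k * (γ * x + δ) := by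
  obtain ⟨hcard, T, μ, h0, hT⟩ := hhyp
  have hμ : (μ : ℂ) ≠ 0 := by exact_mod_cast h0.ne'
  have hdet : T 0 0 * T 1 1 - T 0 1 * T 1 0 ≠ 0 := by
    have := T.det_ne_zero
    rwa [Matrix.det_fin_two] at this
  have hmap_one : ∀ z : OnePoint ℂ, OnePoint.map (fun w : ℂ => 1 * w) z = z := by
    intro z
    cases z with
    | infty => rfl
    | coe w => simp only [OnePoint.map_some, one_mul]
  -- For μ = 1 every point would be fixed, and `ncard` of an infinite set is 0, not 2.
  have hμ1 : (μ : ℂ) ≠ 1 := by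
    intro h
    have : {z : OnePoint ℂ | g • z = z} = Set.univ := by
      refine Set.eq_univ_of_forall fun z => ?_
      rw [Set.mem_ofPred_eq, hT, h, hmap_one, inv_smul_smul]
    rw [this, Set.Infinite.ncard Set.infinite_univ] at hcard
    omega
  have hiter : ∀ (n : ℕ) (z : OnePoint ℂ),
      T • (g ^ n • z) = OnePoint.map (fun w : ℂ => (μ : ℂ) ^ n * w) (T • z) := by
    intro n z
    induction n with
    | zero => simp only [pow_zero, one_smul, hmap_one]
    | succ n ih =>
      rw [pow_succ', mul_smul, hT, smul_inv_smul, ih]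
      cases T • z with
      | infty => rfl
      | coe w => simp only [OnePoint.map_some]; congr 1; ring
  have hrel : ∀ (n : ℕ) (x y : ℂ), g ^ n • (x : OnePoint ℂ) = (y : OnePoint ℂ) →
      ∃ k : ℂ, T 0 0 * y + T 0 1 = k * ((μ : ℂ) ^ n * (T 0 0 * x + T 0 1)) ∧
        T 1 0 * y + T 1 1 = k * (T 1 0 * x + T 1 1) := by
    intro n x y hxy
    refine exists_factor_of_smul_eq T x y (pow_ne_zero n hμ) ?_
    rw [← hiter, hxy]
  obtain ⟨k, hk1, hk2⟩ := hrel 1 η η (by rw [pow_one]; exact hη.1)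
  rw [pow_one] at hk1
  -- The conjugation sends η to ∞ or to 0. In the first case the two forms are exchanged and μ is
  -- replaced by μ⁻¹.
  by_cases hD : T 1 0 * η + T 1 1 = 0
  · have hrel' : ∀ (n : ℕ) (x y : ℂ), g ^ n • (x : OnePoint ℂ) = (y : OnePoint ℂ) →
        ∃ k : ℂ, T 1 0 * y + T 1 1 = k * (((μ⁻¹ : ℝ) : ℂ) ^ n * (T 1 0 * x + T 1 1)) ∧
          T 0 0 * y + T 0 1 = k * (T 0 0 * x + T 0 1) := by
      intro n x y hxy
      obtain ⟨l, hl1, hl2⟩ := hrel n x y hxy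
      refine ⟨l * (μ : ℂ) ^ n, ?_, by rw [hl1]; ring⟩
      have := mul_inv_cancel₀ (pow_ne_zero n hμ)
      rw [hl2]
      push_cast
      rw [inv_pow]
      linear_combination (-l * (T 1 0 * x + T 1 1)) * this
    have hdet' : T 1 0 * T 0 1 - T 1 1 * T 0 0 ≠ 0 := fun h => hdet (by linear_combination -h)
    refine ⟨_, _, _, _, μ⁻¹, hdet', inv_pos.2 h0,
      lt_one_of_isAttractiveFixedPoint hη hdet' (inv_pos.2 h0) hD hrel', hD, fun x y hxy => ?_⟩
    simpa using hrel' 1 x y (by simpa using hxy)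
  · have hk : k = 1 := mul_right_cancel₀ hD (by linear_combination -hk2)
    have hN : T 0 0 * η + T 0 1 = 0 := by
      rw [hk, one_mul] at hk1
      exact (mul_eq_zero.1 (by linear_combination -hk1 :
        ((μ : ℂ) - 1) * (T 0 0 * η + T 0 1) = 0)).resolve_left (sub_ne_zero.2 hμ1)
    refine ⟨_, _, _, _, μ, hdet, h0,
      lt_one_of_isAttractiveFixedPoint hη hdet h0 hN hrel, hN, fun x y hxy => ?_⟩
    simpa using hrel 1 x y (by simpa using hxy)

theorem exists_hasMultiplier (g : GL (Fin 2) ℂ) (φ : 𝔻 → 𝔻)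
    (hφ : IsLinearFractionalAutomorphism g φ) (hhyp : IsHyperbolicLF g)
    (η : ℂ) (hη : IsAttractiveFixedPoint g (η : OnePoint ℂ)) :
    ∃ (ζ : ℂ) (μ : ℝ), ‖η‖ = 1 ∧ ‖ζ‖ = 1 ∧ ζ ≠ η ∧ 0 < μ ∧ μ < 1 ∧ HasMultiplier η ζ μ φ ∧
      HasDerivAt (linearFractional g) (μ : ℂ) η := by
  obtain ⟨α, β, γ, δ, μ, hdet, h0, h1, hαη, hrel⟩ := exists_linear_forms g hhyp η hη
  obtain ⟨ψ, hψl, hψr⟩ := bijective_iff_has_inverse.1 hφ.2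
  have hμ : (μ : ℂ) ≠ 0 := by exact_mod_cast h0.ne'
  have hrelφ := fun z : 𝔻 => hrel z (φ z) (hφ.1 z)
  obtain ⟨η', hη1, hη2⟩ := exists_fixed_of_linear_forms hψr hdet h0 h1 hrelφ
  have hrelψ : ∀ z : 𝔻, ∃ k : ℂ, γ * ψ z + δ = k * (μ * (γ * z + δ)) ∧
      α * ψ z + β = k * (α * z + β) := by
    intro z
    obtain ⟨k, hk1, hk2⟩ := hrelφ (ψ z)
    rw [hψr] at hk1 hk2
    have hk : k ≠ 0 := by
      rintro rfl
      rw [zero_mul] at hk1 hk2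
      exact hdet (by linear_combination α * hk2 - γ * hk1)
    refine ⟨(k * μ)⁻¹, ?_, ?_⟩
    · rw [hk2]; field_simp
    · rw [hk1]; field_simp
  -- The inverse contracts the reciprocal coordinate, so the second fixed point is on the circle for
  -- the same reason.
  obtain ⟨ζ, hζ1, hζ2⟩ := exists_fixed_of_linear_forms (φ := ψ) (ψ := φ) hψl
    (α := γ) (β := δ) (γ := α) (δ := β) (fun h => hdet (by linear_combination -h)) h0 h1 hrelψ
  have hα : α ≠ 0 := by
    rintro rfl
    exact hdet (by linear_combination (-γ) * hαη)
  have hγ : γ ≠ 0 := by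
    rintro rfl
    exact hdet (by linear_combination α * hζ2)
  have hηη : η' = η := mul_left_cancel₀ hα (by linear_combination hη2 - hαη)
  subst hηη
  have hne : ζ ≠ η' := by
    rintro rfl
    exact hdet (by linear_combination α * hζ2 - γ * hη2)
  have hmul : HasMultiplier η' ζ μ φ := by
    intro z
    obtain ⟨k, hk1, hk2⟩ := hrelφ z
    refine mul_left_cancel₀ (mul_ne_zero hα hγ) ?_
    have e1 : α * ((φ z : ℂ) - η') = k * (μ * (α * (z - η'))) := by
      linear_combination hk1 + (k * μ - 1) * hη2
    have e2 : γ * ((φ z : ℂ) - ζ) = k * (γ * (z - ζ)) := by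
      linear_combination hk2 + (k - 1) * hζ2
    linear_combination γ * (z - ζ) * e1 - μ * α * (z - η') * e2
  refine ⟨ζ, μ, hη1, hζ1, hne, h0, h1, hmul, ?_⟩
  have hgdet : g 0 0 * g 1 1 - g 0 1 * g 1 0 ≠ 0 := by
    have := g.det_ne_zero
    rwa [Matrix.det_fin_two] at this
  have hpol : ∀ z : 𝔻, (g 0 0 * z + g 0 1 - η' * (g 1 0 * z + g 1 1)) * (z - ζ) =
      μ * ((z - η') * (g 0 0 * z + g 0 1 - ζ * (g 1 0 * z + g 1 1))) := by
    intro z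
    have e := hφ.1 z
    rw [OnePoint.smul_some_eq_ite] at e
    split_ifs at e with h
    · exact absurd e (OnePoint.infty_ne_coe _)
    rw [OnePoint.coe_eq_coe, div_eq_iff h] at e
    rw [e]
    linear_combination (g 1 0 * (z : ℂ) + g 1 1) * hmul z
  have p0 := hpol 0
  have p1 := hpol (UnitDisc.mk (1 / 2) (by norm_num))
  have p2 := hpol (UnitDisc.mk (-1 / 2) (by norm_num))
  simp only [UnitDisc.coe_zero, UnitDisc.coe_mk] at p0 p1 p2
  have hne' : η' - ζ ≠ 0 := sub_ne_zero.2 hne.symm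
  -- Both sides are polynomials of degree at most 2 that agree at 0 and ±1/2, hence everywhere.
  have hall : ∀ z : ℂ, (g 0 0 * z + g 0 1 - η' * (g 1 0 * z + g 1 1)) * (z - ζ) =
      μ * ((z - η') * (g 0 0 * z + g 0 1 - ζ * (g 1 0 * z + g 1 1))) := by
    intro z
    linear_combination (1 - 4 * z ^ 2) * p0 + (2 * z ^ 2 + z) * p1 + (2 * z ^ 2 - z) * p2
  have q0 : g 0 0 * η' + g 0 1 = η' * (g 1 0 * η' + g 1 1) :=
    mul_right_cancel₀ hne' (by linear_combination hall η')
  -- For quadratic polynomials the central difference at η' is exactly the derivative there.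
  have q1 : g 0 0 - η' * g 1 0 = μ * (g 1 0 * η' + g 1 1) := by
    refine mul_right_cancel₀ hne' ?_
    linear_combination hall (η' + 1) / 2 - hall (η' - 1) / 2 + (μ - 1) * q0
  have hden : g 1 0 * η' + g 1 1 ≠ 0 := by
    intro h
    rw [h, mul_zero] at q0
    exact hgdet (by linear_combination g 0 0 * h - g 1 0 * q0)
  have hd := (((hasDerivAt_id η').const_mul (g 0 0)).add_const (g 0 1)).div
    (((hasDerivAt_id η').const_mul (g 1 0)).add_const (g 1 1)) hden
  convert! hd using 1
  simp only [id, mul_one]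
  field_simp
  linear_combination -(g 1 0 * η' + g 1 1) * q1 + g 1 0 * q0

/-! ### Power sums and slowly varying weights. -/

theorem exists_rpow_le_mul_exp_half {s : ℝ} (hs : 0 ≤ s) :
    ∃ K : ℝ, 0 < K ∧ ∀ x : ℝ, 0 ≤ x → x ^ s ≤ K * Real.exp (x / 2) := by
  obtain ⟨k, hk⟩ := exists_nat_ge s
  refine ⟨1 + 2 ^ k * k.factorial, by positivity, fun x hx => ?_⟩
  have h1 : x ^ s ≤ 1 + x ^ k := by
    rcases le_total x 1 with h | h
    · exact (Real.rpow_le_one hx h hs).trans (le_add_of_nonneg_right (by positivity))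
    · have := Real.rpow_le_rpow_of_exponent_le h hk
      rw [Real.rpow_natCast] at this
      linarith
  have h2 := Real.pow_div_factorial_le_exp (x / 2) (by positivity) k
  rw [div_le_iff₀ (by positivity), div_pow, div_le_iff₀ (by positivity)] at h2
  have h3 : 1 ≤ Real.exp (x / 2) := Real.one_le_exp (by positivity)
  nlinarith

/-- Split r ^ n into two factors √r ^ n. Since √r ≤ exp(-(1 - r) / 2), one of them absorbs (n + 1) ^
s at the cost of (1 - r) ^ (-s); the other sums geometrically to O(1 / (1 - r)). -/
theorem exists_tsum_rpow_mul_pow_le {s : ℝ} (hs : 0 ≤ s) :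
    ∃ C : ℝ, 0 < C ∧ ∀ r : ℝ, 0 ≤ r → r < 1 →
      Summable (fun n : ℕ => ((n : ℝ) + 1) ^ s * r ^ n) ∧
        ∑' n : ℕ, ((n : ℝ) + 1) ^ s * r ^ n ≤ C * (1 - r) ^ (-(s + 1)) := by
  obtain ⟨K, hK, hKx⟩ := exists_rpow_le_mul_exp_half hs
  refine ⟨K * Real.exp 1 * 2, by positivity, fun r h0 h1 => ?_⟩
  have ht : 0 < 1 - r := by linarith
  have hρ1 : √r < 1 := by rw [Real.sqrt_lt' one_pos]; simpa using h1
  have hρ0 : 0 ≤ √r := Real.sqrt_nonneg r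
  have hρr : √r * √r = r := Real.mul_self_sqrt h0
  have hρe : √r ≤ Real.exp (-((1 - r) / 2)) := by
    rw [Real.sqrt_le_left (Real.exp_nonneg _), ← Real.exp_nat_mul]
    have := Real.add_one_le_exp (-(1 - r))
    refine le_trans (by linarith) (this.trans_eq ?_)
    congr 1
    push_cast
    ring
  have key : ∀ n : ℕ, ((n : ℝ) + 1) ^ s * r ^ n ≤
      K * Real.exp 1 * (1 - r) ^ (-s) * √r ^ n := by
    intro n
    have e1 := hKx (((n : ℝ) + 1) * (1 - r)) (by positivity)
    rw [Real.mul_rpow (by positivity) ht.le] at e1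
    have e2 : √r ^ n ≤ Real.exp 1 * Real.exp (-(((n : ℝ) + 1) * (1 - r) / 2)) := by
      refine (pow_le_pow_left₀ hρ0 hρe n).trans ?_
      rw [← Real.exp_nat_mul, ← Real.exp_add, Real.exp_le_exp]
      nlinarith
    have e3 : ((n : ℝ) + 1) ^ s * √r ^ n ≤ K * Real.exp 1 * (1 - r) ^ (-s) := by
      rw [Real.rpow_neg ht.le, ← div_eq_mul_inv, le_div_iff₀ (by positivity)]
      calc ((n : ℝ) + 1) ^ s * √r ^ n * (1 - r) ^ s
          = (((n : ℝ) + 1) ^ s * (1 - r) ^ s) * √r ^ n := by ring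
        _ ≤ (K * Real.exp (((n : ℝ) + 1) * (1 - r) / 2)) *
            (Real.exp 1 * Real.exp (-(((n : ℝ) + 1) * (1 - r) / 2))) := by gcongr
        _ = K * Real.exp 1 * (Real.exp (((n : ℝ) + 1) * (1 - r) / 2) *
            Real.exp (-(((n : ℝ) + 1) * (1 - r) / 2))) := by ring
        _ = K * Real.exp 1 := by rw [← Real.exp_add, add_neg_cancel, Real.exp_zero, mul_one]
    calc ((n : ℝ) + 1) ^ s * r ^ n = ((n : ℝ) + 1) ^ s * √r ^ n * √r ^ n := by
          rw [mul_assoc, ← mul_pow, hρr]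
      _ ≤ _ := by gcongr
  have hg := (hasSum_geometric_of_lt_one hρ0 hρ1).mul_left (K * Real.exp 1 * (1 - r) ^ (-s))
  have hsum : Summable (fun n : ℕ => ((n : ℝ) + 1) ^ s * r ^ n) :=
    Summable.of_nonneg_of_le (fun n => by positivity) key hg.summable
  refine ⟨hsum, (hsum.tsum_le_tsum key hg.summable).trans ?_⟩
  rw [hg.tsum_eq, neg_add, Real.rpow_add ht, Real.rpow_neg_one]
  have h2 : (1 - √r)⁻¹ ≤ 2 * (1 - r)⁻¹ := by
    rw [← div_eq_mul_inv, inv_eq_one_div, div_le_div_iff₀ (by linarith) ht]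
    nlinarith
  calc K * Real.exp 1 * (1 - r) ^ (-s) * (1 - √r)⁻¹
      ≤ K * Real.exp 1 * (1 - r) ^ (-s) * (2 * (1 - r)⁻¹) := by gcongr
    _ = _ := by ring

theorem summable_rpow_mul_pow (s : ℝ) {r : ℝ} (h0 : 0 ≤ r) (h1 : r < 1) :
    Summable (fun n : ℕ => ((n : ℝ) + 1) ^ s * r ^ n) := by
  obtain ⟨C, -, hC⟩ := exists_tsum_rpow_mul_pow_le (le_max_right s 0)
  refine Summable.of_nonneg_of_le (fun n => by positivity) (fun n => ?_) (hC r h0 h1).1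
  gcongr
  · linarith [n.cast_nonneg (α := ℝ)]
  · exact le_max_left _ _

/-- The weight `(n + 1) ^ s` changes by a relative amount `O(1 / (n + 1))` from `n` to `n + 1`. -/
theorem exists_weight_diff_le (s : ℝ) : ∃ K : ℝ, 0 < K ∧ ∀ n : ℕ,
    ((n : ℝ) + 1) * |((n : ℝ) + 1) ^ s - (((n + 1 : ℕ) : ℝ) + 1) ^ s| ≤ K * ((n : ℝ) + 1) ^ s ∧
    ((n : ℝ) + 1) * |((n : ℝ) + 1) ^ s - (((n + 1 : ℕ) : ℝ) + 1) ^ s| ≤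
      K * (((n + 1 : ℕ) : ℝ) + 1) ^ s ∧
    (((n + 1 : ℕ) : ℝ) + 1) ^ s ≤ K * ((n : ℝ) + 1) ^ s := by
  obtain ⟨k, hk⟩ := exists_nat_ge |s|
  have hk2 : (1 : ℝ) ≤ 2 ^ k := one_le_pow₀ (by norm_num)
  have hpow : ∀ t : ℝ, 0 ≤ t → t ≤ 1 → (1 + t) ^ k ≤ 1 + 2 ^ k * t := by
    intro t h0 h1
    have : ∀ m : ℕ, (1 + t) ^ m ≤ 1 + (2 ^ m - 1) * t := by
      intro m
      induction m with
      | zero => simp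
      | succ m ih =>
        have h2 : (1 : ℝ) ≤ 2 ^ m := one_le_pow₀ (by norm_num)
        rw [pow_succ, pow_succ]
        nlinarith [mul_le_mul_of_nonneg_right ih (by linarith : 0 ≤ 1 + t),
          mul_nonneg (mul_nonneg (sub_nonneg.2 h2) h0) (sub_nonneg.2 h1)]
    linarith [this k]
  -- One factor 2 ^ k bounds the relative change of the weight, the other allows for passing from
  -- index n to n + 1.
  refine ⟨2 ^ k * 2 ^ k, by positivity, fun n => ?_⟩
  set t : ℝ := ((n : ℝ) + 1)⁻¹ with ht
  have hn : (0 : ℝ) < (n : ℝ) + 1 := by positivity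
  have ht0 : 0 < t := by positivity
  have ht1 : t ≤ 1 := inv_le_one_of_one_le₀ (by linarith [n.cast_nonneg (α := ℝ)])
  have hnt : ((n : ℝ) + 1) * t = 1 := mul_inv_cancel₀ hn.ne'
  have hw : (((n + 1 : ℕ) : ℝ) + 1) ^ s = ((n : ℝ) + 1) ^ s * (1 + t) ^ s := by
    rw [← Real.mul_rpow hn.le (by positivity)]
    congr 1
    push_cast
    linear_combination -hnt
  have hone : (1 : ℝ) ≤ 1 + t := by linarith
  have hup : (1 + t) ^ s ≤ 1 + 2 ^ k * t := by
    refine le_trans ?_ (hpow t ht0.le ht1)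
    rw [← Real.rpow_natCast]
    exact Real.rpow_le_rpow_of_exponent_le hone ((le_abs_self s).trans hk)
  have hlow : (1 : ℝ) ≤ (1 + t) ^ s * (1 + 2 ^ k * t) := by
    have h1 : (1 + t) ^ (-(k : ℝ)) ≤ (1 + t) ^ s :=
      Real.rpow_le_rpow_of_exponent_le hone (by linarith [neg_abs_le s])
    have h2 : (1 + t) ^ (-(k : ℝ)) * (1 + t) ^ k = 1 := by
      rw [← Real.rpow_natCast, ← Real.rpow_add (by positivity), neg_add_cancel, Real.rpow_zero]
    calc (1 : ℝ) = (1 + t) ^ (-(k : ℝ)) * (1 + t) ^ k := h2.symm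
      _ ≤ _ := mul_le_mul h1 (hpow t ht0.le ht1) (by positivity) (by positivity)
  set x := (1 + t) ^ s with hx
  have hx0 : 0 < x := by positivity
  have hxup : x ≤ 2 ^ k * 2 ^ k := by
    rcases Nat.eq_zero_or_pos k with h | h
    · have : s = 0 := abs_nonpos_iff.1 (by rw [h] at hk; simpa using hk)
      rw [hx, this, h]; simp
    · have : (2 : ℝ) ≤ 2 ^ k := le_self_pow₀ (by norm_num) h.ne'
      nlinarith
  have hdiff : |1 - x| ≤ 2 ^ k * t := by
    rw [abs_le]
    have hA : 0 ≤ 2 ^ k * t := by positivity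
    refine ⟨by linarith, ?_⟩
    by_contra! hc
    nlinarith
  have hxlow : 1 ≤ x * 2 ^ k := by
    have h1 : (1 + t) ^ (-(k : ℝ)) ≤ x :=
      Real.rpow_le_rpow_of_exponent_le hone (by linarith [neg_abs_le s])
    have h2 : (1 + t) ^ (-(k : ℝ)) * (1 + t) ^ k = 1 := by
      rw [← Real.rpow_natCast, ← Real.rpow_add (by positivity), neg_add_cancel, Real.rpow_zero]
    calc (1 : ℝ) = (1 + t) ^ (-(k : ℝ)) * (1 + t) ^ k := h2.symm
      _ ≤ _ := mul_le_mul h1 (pow_le_pow_left₀ (by positivity) (by linarith) k) (by positivity)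
        (by positivity)
  set w := ((n : ℝ) + 1) ^ s with hwdef
  have hw0 : 0 < w := by positivity
  have e : ((n : ℝ) + 1) * |w - w * x| ≤ 2 ^ k * w := by
    rw [show w - w * x = w * (1 - x) by ring, abs_mul, abs_of_pos hw0]
    calc ((n : ℝ) + 1) * (w * |1 - x|) ≤ ((n : ℝ) + 1) * (w * (2 ^ k * t)) := by gcongr
      _ = 2 ^ k * w * (((n : ℝ) + 1) * t) := by ring
      _ = _ := by rw [hnt, mul_one]
  rw [hw]
  refine ⟨e.trans ?_, e.trans ?_, ?_⟩
  · have : 0 < 2 ^ k * w := by positivity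
    nlinarith
  · have : 0 < 2 ^ k * w := by positivity
    nlinarith
  · nlinarith

/-! ### Bounded functionals, the shift and Cauchy kernels. -/

namespace WeightedDirichlet

variable {ν : ℝ}

theorem ext_apply {f g : WeightedDirichlet ν} (h : ∀ z : 𝔻, f z = g z) : f = g :=
  Subtype.ext (funext h)

theorem exists_of_hasSum (F : 𝔻 → ℂ) (a : ℕ → ℂ)
    (hF : ∀ z : 𝔻, HasSum (fun n : ℕ => a n * (z : ℂ) ^ n) (F z))
    (ha : Summable (fun n : ℕ => ‖a n‖ ^ 2 * ((n : ℝ) + 1) ^ (2 * ν))) :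
    ∃ f : WeightedDirichlet ν, (∀ z, f z = F z) ∧ coeff f = a := by
  let f : WeightedDirichlet ν := ⟨F, a, hF, ha⟩
  exact ⟨f, fun z => rfl, (coeff_unique f a hF).symm⟩

/-- Weighted `ℓ²` duality: a sequence `l` with `∑ ‖l n‖ ^ 2 / (n + 1) ^ (2 ν) < ∞` defines a bounded
functional of the Taylor coefficients. -/
theorem exists_hasSum_mul_coeff_inner (l : ℕ → ℂ)
    (hl : Summable (fun n : ℕ => ‖l n‖ ^ 2 * ((n : ℝ) + 1) ^ (-(2 * ν)))) :
    ∃ k : WeightedDirichlet ν, ‖k‖ ^ 2 = ∑' n : ℕ, ‖l n‖ ^ 2 * ((n : ℝ) + 1) ^ (-(2 * ν)) ∧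
      ∀ f : WeightedDirichlet ν, HasSum (fun n => l n * coeff f n) (inner ℂ k f) := by
  have hw : ∀ n : ℕ, (0 : ℝ) < ((n : ℝ) + 1) ^ (2 * ν) := fun n => by positivity
  have e : ∀ n : ℕ, ‖conj (l n) * ((((n : ℝ) + 1) ^ (-(2 * ν)) : ℝ) : ℂ)‖ ^ 2 *
      ((n : ℝ) + 1) ^ (2 * ν) = ‖l n‖ ^ 2 * ((n : ℝ) + 1) ^ (-(2 * ν)) := by
    intro n
    have := hw n
    rw [Real.rpow_neg (by positivity), norm_mul, RCLike.norm_conj, norm_real,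
      Real.norm_of_nonneg (by positivity)]
    field_simp
  obtain ⟨k, hk⟩ := exists_coeff_eq (ν := ν)
    (fun n => conj (l n) * ((((n : ℝ) + 1) ^ (-(2 * ν)) : ℝ) : ℂ)) (hl.congr fun n => (e n).symm)
  refine ⟨k, ?_, fun f => ?_⟩
  · rw [norm_sq_eq, hk]
    exact tsum_congr e
  · rw [inner_def]
    convert! (summable_inner k f).hasSum using 2 with n
    have h1 : ((((n : ℝ) + 1) ^ (-(2 * ν)) : ℝ) : ℂ) * ((((n : ℝ) + 1) ^ (2 * ν) : ℝ) : ℂ) = 1 := by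
      rw [← ofReal_mul, Real.rpow_neg (by positivity), inv_mul_cancel₀ (hw n).ne', ofReal_one]
    rw [hk, map_mul, conj_conj, conj_ofReal]
    linear_combination (-(l n * coeff f n)) * h1

theorem summable_sq_mul_pow (z : 𝔻) (s : ℝ) :
    Summable (fun n : ℕ => ‖(z : ℂ) ^ n‖ ^ 2 * ((n : ℝ) + 1) ^ s) := by
  refine (summable_rpow_mul_pow s (sq_nonneg ‖(z : ℂ)‖) z.sq_norm_lt_one).congr fun n => ?_
  rw [norm_pow, ← pow_mul, ← pow_mul, mul_comm 2 n, mul_comm]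

theorem continuous_eval (z : 𝔻) : Continuous fun f : WeightedDirichlet ν => f z := by
  obtain ⟨k, -, hk⟩ := exists_hasSum_mul_coeff_inner (ν := ν) (fun n => (z : ℂ) ^ n)
    (summable_sq_mul_pow z _)
  have : (fun f : WeightedDirichlet ν => f z) = fun f => inner ℂ k f := by
    funext f
    refine (hasSum_coeff f z).unique ?_
    simpa only [mul_comm] using hk f
  rw [this]
  fun_prop

/-- A weighted composition `f ↦ m · (f ∘ φ)` that is bounded on a dense subspace extends to `S_ν`. -/
theorem exists_weightedComposition_of_dense (m : 𝔻 → ℂ) (φ : 𝔻 → 𝔻)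
    (D : Submodule ℂ (WeightedDirichlet ν)) (hD : Dense (D : Set (WeightedDirichlet ν))) (K : ℝ)
    (h : ∀ f ∈ D, ∃ g : WeightedDirichlet ν, (∀ z, g z = m z * f (φ z)) ∧ ‖g‖ ≤ K * ‖f‖) :
    ∃ T : WeightedDirichlet ν →L[ℂ] WeightedDirichlet ν,
      ∀ (f : WeightedDirichlet ν) (z : 𝔻), T f z = m z * f (φ z) := by
  choose G hG1 hG2 using fun f : D => h f f.2
  let L : D →ₗ[ℂ] WeightedDirichlet ν :=
    { toFun := G
      map_add' := fun f g => ext_apply fun z => by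
        rw [coe_add, hG1, hG1, hG1, Submodule.coe_add, coe_add, mul_add]
      map_smul' := fun c f => ext_apply fun z => by
        rw [RingHom.id_apply, coe_smul, hG1, hG1, Submodule.coe_smul, coe_smul]
        ring }
  have hdr : DenseRange D.subtype := by
    rw [DenseRange, Submodule.coe_subtype, Subtype.range_coe]
    exact hD
  refine ⟨L.extendOfNorm D.subtype, fun f z => ?_⟩
  refine hdr.induction_on (p := fun f => (L.extendOfNorm D.subtype) f z = m z * f (φ z)) f ?_ ?_
  -- Evaluations are continuous, so the pointwise formula passes from the dense subspace to the
  -- extension.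
  · exact isClosed_eq ((continuous_eval z).comp (ContinuousLinearMap.continuous _))
      (continuous_const.mul (continuous_eval (φ z)))
  · intro a
    rw [LinearMap.extendOfNorm_eq hdr ⟨K, hG2⟩]
    exact hG1 a z

theorem exists_shift (ν : ℝ) : ∃ M : WeightedDirichlet ν →L[ℂ] WeightedDirichlet ν,
    ∀ (f : WeightedDirichlet ν) (z : 𝔻), M f z = z * f z := by
  obtain ⟨K, hK, hw⟩ := exists_weight_diff_le (2 * ν)
  refine exists_weightedComposition_of_dense (fun z => z) id ⊤ dense_univ √K fun f _ => ?_
  let a : ℕ → ℂ := fun n => Nat.casesOn n 0 (coeff f)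
  have hle : ∀ n : ℕ, ‖a (n + 1)‖ ^ 2 * (((n + 1 : ℕ) : ℝ) + 1) ^ (2 * ν) ≤
      K * (‖coeff f n‖ ^ 2 * ((n : ℝ) + 1) ^ (2 * ν)) := by
    intro n
    change ‖coeff f n‖ ^ 2 * _ ≤ _
    nlinarith [mul_le_mul_of_nonneg_left (hw n).2.2 (sq_nonneg ‖coeff f n‖)]
  have hs1 : Summable (fun n : ℕ => ‖a (n + 1)‖ ^ 2 * (((n + 1 : ℕ) : ℝ) + 1) ^ (2 * ν)) :=
    Summable.of_nonneg_of_le (fun n => by positivity) hle ((summable_coeff f).mul_left K)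
  have hs : Summable (fun n : ℕ => ‖a n‖ ^ 2 * ((n : ℝ) + 1) ^ (2 * ν)) :=
    (summable_nat_add_iff 1).1 hs1
  obtain ⟨g, hg1, hg2⟩ := exists_of_hasSum (fun z : 𝔻 => (z : ℂ) * f z) a (fun z => by
    rw [← hasSum_nat_add_iff' 1]
    simp only [Finset.range_one, Finset.sum_singleton]
    have h1 : a 0 = 0 := rfl
    rw [h1, zero_mul, sub_zero]
    refine ((hasSum_coeff f z).mul_left (z : ℂ)).congr_fun fun n => ?_
    change coeff f n * _ = _
    ring) hs
  refine ⟨g, hg1, ?_⟩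
  refine abs_le_of_sq_le_sq' ?_ (by positivity) |>.2
  rw [mul_pow, Real.sq_sqrt hK.le, norm_sq_eq, norm_sq_eq, hg2, hs.tsum_eq_zero_add]
  have h1 : a 0 = 0 := rfl
  rw [h1, norm_zero, zero_pow two_ne_zero, zero_mul, zero_add, ← tsum_mul_left]
  exact hs1.tsum_le_tsum hle ((summable_coeff f).mul_left K)

theorem exists_cauchyKernel (ν : ℝ) (b : 𝔻) : ∃ k : WeightedDirichlet ν,
    (∀ z : 𝔻, k z = (1 - b * z : ℂ)⁻¹) ∧ coeff k = fun n => (b : ℂ) ^ n := by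
  refine exists_of_hasSum _ _ (fun z => ?_) (summable_sq_mul_pow b _)
  have : ‖(b : ℂ) * z‖ < 1 := by
    rw [← UnitDisc.coe_mul]; exact (b * z).norm_lt_one
  simpa only [mul_pow] using hasSum_geometric_of_norm_lt_one this

/-- The Cauchy kernel `z ↦ 1 / (1 - b z)`. -/
noncomputable def cauchyKernel (ν : ℝ) (b : 𝔻) : WeightedDirichlet ν :=
  Classical.choose (exists_cauchyKernel ν b)

theorem cauchyKernel_apply (b z : 𝔻) : cauchyKernel ν b z = (1 - b * z : ℂ)⁻¹ :=
  (Classical.choose_spec (exists_cauchyKernel ν b)).1 z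

theorem coeff_cauchyKernel (b : 𝔻) : coeff (cauchyKernel ν b) = fun n => (b : ℂ) ^ n :=
  (Classical.choose_spec (exists_cauchyKernel ν b)).2

/-- For f orthogonal to every kernel, the power series with coefficients conj(aₙ) (n + 1) ^ (2ν)
vanishes on the disk, and its coefficients are zero. -/
theorem dense_span_cauchyKernel :
    Dense (Submodule.span ℂ (Set.range (cauchyKernel ν)) : Set (WeightedDirichlet ν)) := by
  rw [Submodule.dense_iff_topologicalClosure_eq_top, Submodule.topologicalClosure_eq_top_iff,
    Submodule.eq_bot_iff]
  intro f hf
  have h1 : ∀ b : 𝔻, HasSum (fun n : ℕ => (conj (coeff f n) *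
      (((n : ℝ) + 1) ^ (2 * ν) : ℝ)) * (b : ℂ) ^ n) ((0 : WeightedDirichlet ν) b) := by
    intro b
    have h2 : inner ℂ f (cauchyKernel ν b) = 0 :=
      (Submodule.mem_orthogonal' _ _).1 hf _ (Submodule.subset_span ⟨b, rfl⟩)
    have h3 := (summable_inner f (cauchyKernel ν b)).hasSum
    rw [← inner_def, h2, coeff_cauchyKernel] at h3
    refine h3.congr_fun fun n => ?_
    ring
  have h4 := coeff_unique 0 _ h1
  have h5 : coeff (0 : WeightedDirichlet ν) = 0 :=
    (coeff_unique 0 0 fun z => by simp only [Pi.zero_apply, zero_mul]; exact hasSum_zero).symm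
  refine eq_zero_of_coeff f fun n => ?_
  have h6 := congrFun h4 n
  rw [h5] at h6
  have h7 : ((((n : ℝ) + 1) ^ (2 * ν) : ℝ) : ℂ) ≠ 0 := by
    rw [ofReal_ne_zero]; positivity
  simpa [h7] using h6

end WeightedDirichlet

/-! ### Boundedness of composition operators. -/

/-- Gronwall estimate for the weighted `ℓ²` norm along the flow generated by the matrix of
`(1 - z ^ 2) d/dz`, up to a bounded perturbation. -/
theorem exists_energy_bound (s : ℝ) {R : ℝ} (hR0 : 0 < R) (hR1 : R < 1) :
    ∃ L : ℝ, 0 ≤ L ∧ ∀ v : ℕ → ℝ → ℂ,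
      (∀ n : ℕ, ∀ r ∈ Set.Ioo (-R) R, HasDerivAt (v n)
        ((((n : ℂ) + 1) * v (n + 1) r - n * v (n - 1) r + r * v n r) / (1 - (r : ℂ) ^ 2)) r) →
      (∃ ρ B : ℝ, 0 ≤ ρ ∧ ρ < 1 ∧ ∀ n : ℕ, ∀ r ∈ Set.Ioo (-R) R, ‖v n r‖ ≤ B * ρ ^ n) →
      ∀ r : ℝ, 0 ≤ r → r < R → ∑' n : ℕ, ‖v n r‖ ^ 2 * ((n : ℝ) + 1) ^ s ≤
        L * ∑' n : ℕ, ‖v n 0‖ ^ 2 * ((n : ℝ) + 1) ^ s := by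
  obtain ⟨K, hK, hw⟩ := exists_weight_diff_le s
  have hR2 : 0 < 1 - R ^ 2 := by nlinarith
  -- The weight differences contribute 2K, the diagonal term 2 r contributes at most 2.
  set A : ℝ := (2 * K + 2) / (1 - R ^ 2) with hA
  refine ⟨Real.exp A, (Real.exp_pos _).le, fun v hv ⟨ρ, B, hρ0, hρ1, hB⟩ => ?_⟩
  have h0mem : (0 : ℝ) ∈ Set.Ioo (-R) R := ⟨by linarith, hR0⟩
  have hB0 : 0 ≤ B := by simpa using (norm_nonneg _).trans (hB 0 0 h0mem)
  have hρn : ∀ n : ℕ, ρ ^ n ≤ 1 := fun n => pow_le_one₀ hρ0 hρ1.le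
  have hB1 : ∀ n : ℕ, ∀ r ∈ Set.Ioo (-R) R, ‖v n r‖ ≤ B := fun n r hr =>
    (hB n r hr).trans (mul_le_of_le_one_right hB0 (hρn n))
  set W : ℕ → ℝ := fun n => ((n : ℝ) + 1) ^ s with hW
  have hW0 : ∀ n, 0 < W n := fun n => by positivity
  have hn0 : ∀ n : ℕ, (0 : ℝ) < (n : ℝ) + 1 := fun n => by positivity
  have hnn : ∀ n : ℕ, (0 : ℝ) ≤ (n : ℝ) := fun n => n.cast_nonneg
  have hW1 : ∀ n : ℕ, ((n : ℝ) + 1) ^ (s + 1) = W n * ((n : ℝ) + 1) := fun n => by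
    rw [Real.rpow_add (hn0 n), Real.rpow_one]
  have hr2 : ∀ r ∈ Set.Ioo (-R) R, 1 - R ^ 2 ≤ 1 - r ^ 2 ∧ |r| ≤ 1 := by
    intro r hr
    refine ⟨by nlinarith [hr.1, hr.2], abs_le.2 ⟨by linarith [hr.1], by linarith [hr.2]⟩⟩
  set v' : ℕ → ℝ → ℂ := fun n r =>
    (((n : ℂ) + 1) * v (n + 1) r - n * v (n - 1) r + r * v n r) / (1 - (r : ℂ) ^ 2) with hv'
  set D : ℕ → ℝ → ℝ := fun n r => 2 * (conj (v n r) * v' n r).re * W n with hD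
  have hDd : ∀ n : ℕ, ∀ r ∈ Set.Ioo (-R) R, HasDerivAt (fun r => ‖v n r‖ ^ 2 * W n) (D n r) r := by
    intro n r hr
    have := ((hv n r hr).norm_sq).mul_const (W n)
    rwa [Complex.inner, mul_comm _ (conj _)] at this
  have hsum1 : Summable (fun n : ℕ => ((n : ℝ) + 1) ^ (s + 1) * ρ ^ n) :=
    summable_rpow_mul_pow _ hρ0 hρ1
  have hnormden : ∀ r ∈ Set.Ioo (-R) R, 1 - R ^ 2 ≤ ‖1 - (r : ℂ) ^ 2‖ := by
    intro r hr
    rw [← ofReal_pow, ← ofReal_one, ← ofReal_sub, norm_real, Real.norm_eq_abs]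
    exact (hr2 r hr).1.trans (le_abs_self _)
  have hv'b : ∀ n : ℕ, ∀ r ∈ Set.Ioo (-R) R,
      ‖v' n r‖ ≤ ((n : ℝ) + 1) * (3 * B) / (1 - R ^ 2) := by
    intro n r hr
    rw [hv']
    simp only [norm_div]
    refine div_le_div₀ (by positivity) ?_ hR2 (hnormden r hr)
    have e1 : ‖((n : ℂ) + 1) * v (n + 1) r‖ ≤ ((n : ℝ) + 1) * B := by
      rw [norm_mul]
      refine mul_le_mul (le_of_eq ?_) (hB1 _ r hr) (norm_nonneg _) (hn0 n).le
      rw [← Nat.cast_add_one, Complex.norm_natCast, Nat.cast_add_one]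
    have e2 : ‖(n : ℂ) * v (n - 1) r‖ ≤ (n : ℝ) * B := by
      rw [norm_mul, Complex.norm_natCast]
      exact mul_le_mul_of_nonneg_left (hB1 _ r hr) (hnn n)
    have e3 : ‖(r : ℂ) * v n r‖ ≤ B := by
      rw [norm_mul, norm_real, Real.norm_eq_abs]
      exact (mul_le_of_le_one_left (norm_nonneg _) (hr2 r hr).2).trans (hB1 _ r hr)
    refine (norm_add_le _ _).trans ((add_le_add (norm_sub_le _ _) le_rfl).trans ?_)
    nlinarith [hnn n]
  have hDb : ∀ n : ℕ, ∀ r ∈ Set.Ioo (-R) R, ‖D n r‖ ≤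
      2 * B * (3 * B / (1 - R ^ 2)) * (((n : ℝ) + 1) ^ (s + 1) * ρ ^ n) := by
    intro n r hr
    rw [hD, hW1]
    simp only [Real.norm_eq_abs, abs_mul, abs_two, abs_of_pos (hW0 n)]
    have e1 : |(conj (v n r) * v' n r).re| ≤ ‖v n r‖ * ‖v' n r‖ := by
      refine (abs_re_le_norm _).trans ?_
      rw [norm_mul, RCLike.norm_conj]
    have e2 : ‖v n r‖ * ‖v' n r‖ ≤ (B * ρ ^ n) * (((n : ℝ) + 1) * (3 * B) / (1 - R ^ 2)) := by
      have := hB n r hr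
      have := hv'b n r hr
      gcongr
    calc 2 * |(conj (v n r) * v' n r).re| * W n
        ≤ 2 * ((B * ρ ^ n) * (((n : ℝ) + 1) * (3 * B) / (1 - R ^ 2))) * W n := by
          have := hW0 n
          gcongr
          exact e1.trans e2
      _ = _ := by ring
  have hNs : ∀ r ∈ Set.Ioo (-R) R, Summable (fun n => ‖v n r‖ ^ 2 * W n) := by
    intro r hr
    refine Summable.of_nonneg_of_le (fun n => by have := hW0 n; positivity) (fun n => ?_)
      (hsum1.mul_left (B * B))
    have e1 : ‖v n r‖ ^ 2 ≤ B * (B * ρ ^ n) := by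
      rw [sq]
      exact mul_le_mul (hB1 n r hr) (hB n r hr) (norm_nonneg _) hB0
    rw [hW1]
    have e2 : W n ≤ W n * ((n : ℝ) + 1) := le_mul_of_one_le_right (hW0 n).le (by linarith [hnn n])
    calc ‖v n r‖ ^ 2 * W n ≤ (B * (B * ρ ^ n)) * (W n * ((n : ℝ) + 1)) :=
          mul_le_mul e1 e2 (hW0 n).le (by positivity)
      _ = _ := by ring
  set N : ℝ → ℝ := fun r => ∑' n, ‖v n r‖ ^ 2 * W n with hN
  have hNnn : ∀ r, 0 ≤ N r := fun r => tsum_nonneg fun n => by have := hW0 n; positivity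
  have hNd : ∀ r ∈ Set.Ioo (-R) R, HasDerivAt N (∑' n, D n r) r := fun r hr =>
    hasDerivAt_tsum_of_isPreconnected (hsum1.mul_left (2 * B * (3 * B / (1 - R ^ 2)))) isOpen_Ioo
      isPreconnected_Ioo hDd hDb h0mem (hNs 0 h0mem) hr
  have hbound : ∀ r ∈ Set.Ioo (-R) R, ‖∑' n, D n r‖ ≤ A * ‖N r‖ + 0 := by
    intro r hr
    have hr1 := (hr2 r hr).1
    have hden : (1 - r ^ 2) ≠ 0 := by linarith
    set p : ℕ → ℝ := fun n => ((n : ℝ) + 1) * (conj (v n r) * v (n + 1) r).re with hp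
    set q : ℕ → ℝ := fun n => (n : ℝ) * (conj (v n r) * v (n - 1) r).re with hq
    have hpb : ∀ n, |p n| ≤ ((n : ℝ) + 1) * (‖v n r‖ * ‖v (n + 1) r‖) := by
      intro n
      rw [hp]
      simp only [abs_mul, abs_of_pos (hn0 n)]
      refine mul_le_mul_of_nonneg_left ((abs_re_le_norm _).trans ?_) (hn0 n).le
      rw [norm_mul, RCLike.norm_conj]
    have hqb : ∀ n, |q n| ≤ ((n : ℝ) + 1) * (‖v n r‖ * ‖v (n - 1) r‖) := by
      intro n
      rw [hq]
      simp only [abs_mul, abs_of_nonneg (hnn n)]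
      refine mul_le_mul (by linarith) ((abs_re_le_norm _).trans ?_) (abs_nonneg _) (hn0 n).le
      rw [norm_mul, RCLike.norm_conj]
    have hprod : ∀ n m, ‖v n r‖ * ‖v m r‖ ≤ B * ρ ^ n * B := fun n m =>
      mul_le_mul (hB n r hr) (hB1 m r hr) (norm_nonneg _) (by positivity)
    have hps : Summable (fun n => W n * p n) := by
      refine Summable.of_norm_bounded (hsum1.mul_left (B * B)) fun n => ?_
      rw [Real.norm_eq_abs, abs_mul, abs_of_pos (hW0 n), hW1]
      calc W n * |p n| ≤ W n * (((n : ℝ) + 1) * (B * ρ ^ n * B)) := by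
            refine mul_le_mul_of_nonneg_left ((hpb n).trans ?_) (hW0 n).le
            exact mul_le_mul_of_nonneg_left (hprod _ _) (hn0 n).le
        _ = _ := by ring
    have hqs : Summable (fun n => W n * q n) := by
      refine Summable.of_norm_bounded (hsum1.mul_left (B * B)) fun n => ?_
      rw [Real.norm_eq_abs, abs_mul, abs_of_pos (hW0 n), hW1]
      calc W n * |q n| ≤ W n * (((n : ℝ) + 1) * (B * ρ ^ n * B)) := by
            refine mul_le_mul_of_nonneg_left ((hqb n).trans ?_) (hW0 n).le
            exact mul_le_mul_of_nonneg_left (hprod _ _) (hn0 n).le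
        _ = _ := by ring
    -- Skew-symmetry: after summation by parts only the differences W n - W (n + 1) multiply p n. At
    -- n = 0 the truncated index n - 1 is harmless, as q 0 = 0.
    have hqp : ∀ n, q (n + 1) = p n := by
      intro n
      simp only [hp, hq, Nat.add_sub_cancel, Nat.cast_add_one]
      congr 1
      rw [← conj_re, map_mul, conj_conj, mul_comm]
    have hDeq : ∀ n, D n r = (1 - r ^ 2)⁻¹ * (2 * (W n * p n) - 2 * (W n * q n) +
        2 * r * (‖v n r‖ ^ 2 * W n)) := by
      intro n
      have e1 : conj (v n r) * v' n r = (((1 - r ^ 2)⁻¹ : ℝ) : ℂ) *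
          ((((n : ℝ) + 1 : ℝ) : ℂ) * (conj (v n r) * v (n + 1) r) -
            ((n : ℝ) : ℂ) * (conj (v n r) * v (n - 1) r) + (r : ℂ) * ((‖v n r‖ ^ 2 : ℝ) : ℂ)) := by
        rw [hv']
        push_cast
        rw [← conj_mul']
        simp only [div_eq_inv_mul]
        ring
      rw [hD]
      simp only
      rw [e1, re_ofReal_mul, add_re, sub_re, re_ofReal_mul, re_ofReal_mul, re_ofReal_mul, ofReal_re]
      ring
    have hqs' : Summable (fun n => W (n + 1) * p n) := by
      refine ((summable_nat_add_iff 1).2 hqs).congr fun n => ?_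
      rw [hqp]
    have hsumD : ∑' n, D n r = (1 - r ^ 2)⁻¹ *
        (2 * ∑' n, (W n - W (n + 1)) * p n + 2 * r * N r) := by
      have e2 : ∑' n, W n * q n = ∑' n, W (n + 1) * p n := by
        rw [hqs.tsum_eq_zero_add]
        simp only [hqp]
        simp [hq]
      simp only [hDeq, sub_mul]
      rw [tsum_mul_left, ((hps.mul_left 2).sub (hqs.mul_left 2)).tsum_add
        ((hNs r hr).mul_left (2 * r)), (hps.mul_left 2).tsum_sub (hqs.mul_left 2),
        tsum_mul_left, tsum_mul_left, tsum_mul_left, e2, hps.tsum_sub hqs']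
      ring
    have hterm : ∀ n, ‖(W n - W (n + 1)) * p n‖ ≤
        K / 2 * (‖v n r‖ ^ 2 * W n) + K / 2 * (‖v (n + 1) r‖ ^ 2 * W (n + 1)) := by
      intro n
      obtain ⟨w1, w2, -⟩ := hw n
      rw [Real.norm_eq_abs, abs_mul]
      have e3 : |W n - W (n + 1)| * |p n| ≤
          (((n : ℝ) + 1) * |W n - W (n + 1)|) * (‖v n r‖ * ‖v (n + 1) r‖) := by
        calc |W n - W (n + 1)| * |p n|
            ≤ |W n - W (n + 1)| * (((n : ℝ) + 1) * (‖v n r‖ * ‖v (n + 1) r‖)) := by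
              gcongr
              exact hpb n
          _ = _ := by ring
      refine e3.trans ?_
      have hc : 0 ≤ ((n : ℝ) + 1) * |W n - W (n + 1)| := by positivity
      have e4 : ‖v n r‖ * ‖v (n + 1) r‖ ≤ ‖v n r‖ ^ 2 / 2 + ‖v (n + 1) r‖ ^ 2 / 2 := by
        nlinarith [sq_nonneg (‖v n r‖ - ‖v (n + 1) r‖)]
      have f1 := mul_le_mul_of_nonneg_left e4 hc
      have f2 := mul_le_mul_of_nonneg_right w1 (sq_nonneg ‖v n r‖)
      have f3 := mul_le_mul_of_nonneg_right w2 (sq_nonneg ‖v (n + 1) r‖)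
      simp only [hW] at f1 f2 f3 ⊢
      nlinarith
    have hNs1 := (summable_nat_add_iff 1).2 (hNs r hr)
    have hmaj := ((hNs r hr).mul_left (K / 2)).add (hNs1.mul_left (K / 2))
    have hS : |∑' n, (W n - W (n + 1)) * p n| ≤ K * N r := by
      rw [← Real.norm_eq_abs]
      refine (tsum_of_norm_bounded hmaj.hasSum hterm).trans ?_
      rw [((hNs r hr).mul_left (K / 2)).tsum_add (hNs1.mul_left (K / 2)), tsum_mul_left,
        tsum_mul_left]
      have : ∑' n, ‖v (n + 1) r‖ ^ 2 * W (n + 1) ≤ N r := by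
        rw [hN]
        simp only
        rw [(hNs r hr).tsum_eq_zero_add]
        have := hW0 0
        exact le_add_of_nonneg_left (by positivity)
      change K / 2 * N r + _ ≤ _
      nlinarith
    rw [add_zero, hsumD, norm_mul, Real.norm_of_nonneg (inv_nonneg.2 (by linarith)),
      Real.norm_of_nonneg (hNnn r), hA, div_mul_eq_mul_div, inv_mul_eq_div]
    refine div_le_div₀ (by have := hNnn r; positivity) ?_ hR2 hr1
    rw [Real.norm_eq_abs]
    refine (abs_add_le _ _).trans ?_
    rw [abs_mul, abs_mul, abs_mul, abs_two, abs_of_nonneg (hNnn r)]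
    nlinarith [hNnn r, mul_le_mul_of_nonneg_right (hr2 r hr).2 (hNnn r)]
  intro r h0 hrR
  have hmem : ∀ x ∈ Set.Icc 0 r, x ∈ Set.Ioo (-R) R := fun x hx =>
    ⟨by linarith [hx.1], by linarith [hx.2]⟩
  have hA0 : 0 ≤ A := by positivity
  have hG := norm_le_gronwallBound_of_norm_deriv_right_le (f := N) (f' := fun x => ∑' n, D n x)
    (δ := N 0) (K := A) (ε := 0) (a := 0) (b := r)
    (fun x hx => (hNd x (hmem x hx)).continuousAt.continuousWithinAt)
    (fun x hx => (hNd x (hmem x ⟨hx.1, hx.2.le⟩)).hasDerivWithinAt)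
    (Real.norm_of_nonneg (hNnn 0)).le (fun x hx => hbound x (hmem x ⟨hx.1, hx.2.le⟩))
    r ⟨h0, le_rfl⟩
  rw [gronwallBound_ε0, sub_zero, Real.norm_of_nonneg (hNnn r)] at hG
  refine hG.trans ?_
  rw [mul_comm]
  refine mul_le_mul_of_nonneg_right (Real.exp_le_exp.2 ?_) (hNnn 0)
  nlinarith

/-- The coefficients of `z ↦ 1 / ((1 - β r) - (β - r) z)`. -/
noncomputable def flowCoeff (β : ℂ) (n : ℕ) (r : ℝ) : ℂ := (β - r) ^ n / (1 - β * r) ^ (n + 1)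

theorem one_sub_mul_ofReal_ne_zero {β : ℂ} (hβ : ‖β‖ < 1) {r : ℝ} (hr : |r| < 1) :
    1 - β * r ≠ 0 := by
  intro h
  have h1 : ‖β * r‖ = 1 := by rw [← sub_eq_zero.1 h, norm_one]
  rw [norm_mul, norm_real, Real.norm_eq_abs] at h1
  nlinarith [norm_nonneg β, abs_nonneg r]

theorem hasDerivAt_flowCoeff {β : ℂ} (hβ : ‖β‖ < 1) (n : ℕ) {r : ℝ} (hr : |r| < 1) :
    HasDerivAt (flowCoeff β n) ((((n : ℂ) + 1) * flowCoeff β (n + 1) r -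
      n * flowCoeff β (n - 1) r + r * flowCoeff β n r) / (1 - (r : ℂ) ^ 2)) r := by
  have hne := one_sub_mul_ofReal_ne_zero hβ hr
  have hr2 : (1 : ℂ) - (r : ℂ) ^ 2 ≠ 0 := by
    rw [← ofReal_pow, ← ofReal_one, ← ofReal_sub, ofReal_ne_zero]
    nlinarith [abs_lt.1 hr |>.1, abs_lt.1 hr |>.2]
  have h1 : HasDerivAt (fun x : ℂ => (β - x) ^ n / (1 - β * x) ^ (n + 1)) _ (r : ℂ) :=
    (((hasDerivAt_id (r : ℂ)).const_sub β).pow n).div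
      ((((hasDerivAt_id (r : ℂ)).const_mul β).const_sub 1).pow (n + 1)) (pow_ne_zero _ hne)
  have h2 := h1.comp_ofReal
  refine h2.congr_deriv ?_
  cases n with
  | zero =>
    simp [flowCoeff]
    field_simp
    ring
  | succ n =>
    simp [flowCoeff]
    field_simp
    ring

/-- The Schwarz–Pick identity for the automorphism β ↦ (β - r) / (1 - β r). -/
theorem norm_sub_ofReal_sq (β : ℂ) (r : ℝ) :
    ‖β - r‖ ^ 2 = ‖1 - β * r‖ ^ 2 - (1 - ‖β‖ ^ 2) * (1 - r ^ 2) := by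
  simp only [← normSq_eq_norm_sq, normSq_apply, sub_re, sub_im, mul_re, mul_im, ofReal_re,
    ofReal_im, one_re, one_im]
  ring

theorem norm_sub_ofReal_lt {β : ℂ} (hβ : ‖β‖ < 1) {r : ℝ} (hr : |r| < 1) :
    ‖β - r‖ < ‖1 - β * r‖ := by
  refine lt_of_pow_lt_pow_left₀ 2 (norm_nonneg _) ?_
  rw [norm_sub_ofReal_sq]
  have h1 : 0 < 1 - ‖β‖ ^ 2 := by nlinarith [norm_nonneg β]
  have h2 : 0 < 1 - r ^ 2 := by rw [← sq_abs]; nlinarith [abs_nonneg r]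
  have := mul_pos h1 h2
  linarith

theorem exists_norm_flowCoeff_le {β : ℂ} (hβ : ‖β‖ < 1) {R : ℝ} (hR0 : 0 < R) (hR1 : R < 1) :
    ∃ ρ B : ℝ, 0 ≤ ρ ∧ ρ < 1 ∧ 0 ≤ B ∧
      ∀ n : ℕ, ∀ r ∈ Set.Ioo (-R) R, ‖flowCoeff β n r‖ ≤ B * ρ ^ n := by
  have hb : 0 < 1 - ‖β‖ ^ 2 := by nlinarith [norm_nonneg β]
  have hR2 : 0 < 1 - R ^ 2 := by nlinarith
  have hb1 : 1 - ‖β‖ ^ 2 ≤ 1 := by nlinarith [sq_nonneg ‖β‖]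
  have hR3 : 1 - R ^ 2 ≤ 1 := by nlinarith
  -- Divide the Schwarz–Pick identity by ‖1 - β r‖ ^ 2 ≤ 4: c bounds the squared ratio uniformly in
  -- r.
  set c := 1 - (1 - ‖β‖ ^ 2) * (1 - R ^ 2) / 4 with hc
  have hc0 : 0 ≤ c := by nlinarith
  have hc1 : c < 1 := by have := mul_pos hb hR2; rw [hc]; linarith
  refine ⟨√c, (1 - R)⁻¹, Real.sqrt_nonneg _, by rw [Real.sqrt_lt' one_pos]; simpa using hc1,
    inv_nonneg.2 (by linarith), fun n r hr => ?_⟩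
  have hrR : |r| < R := abs_lt.2 hr
  have hne := one_sub_mul_ofReal_ne_zero hβ (hrR.trans hR1)
  have hβr : ‖β * r‖ ≤ |r| := by
    rw [norm_mul, norm_real, Real.norm_eq_abs]
    exact mul_le_of_le_one_left (abs_nonneg r) hβ.le
  have hlow : 1 - R ≤ ‖1 - β * r‖ := by
    have := norm_sub_norm_le (1 : ℂ) (β * r)
    rw [norm_one] at this
    linarith
  have hup : ‖1 - β * r‖ ≤ 2 := by
    have := norm_sub_le (1 : ℂ) (β * r)
    rw [norm_one] at this
    linarith
  have hup2 : ‖1 - β * r‖ ^ 2 ≤ 4 := by nlinarith [norm_nonneg (1 - β * r)]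
  have hle : ‖β - r‖ ≤ √c * ‖1 - β * r‖ := by
    refine le_of_sq_le_sq ?_ (by positivity)
    rw [mul_pow, Real.sq_sqrt hc0, norm_sub_ofReal_sq, hc]
    have hr2 : 1 - R ^ 2 ≤ 1 - r ^ 2 := by rw [← sq_abs r]; nlinarith [abs_nonneg r]
    have h1 := mul_le_mul_of_nonneg_left hr2 hb.le
    have h2 := mul_le_mul_of_nonneg_left hup2 (mul_pos hb hR2).le
    nlinarith
  rw [flowCoeff, norm_div, norm_pow, norm_pow, div_le_iff₀ (by positivity)]
  calc ‖β - r‖ ^ n ≤ (√c * ‖1 - β * r‖) ^ n := pow_le_pow_left₀ (norm_nonneg _) hle n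
    _ = 1 * (√c ^ n * ‖1 - β * r‖ ^ n) := by ring
    _ ≤ ((1 - R)⁻¹ * ‖1 - β * r‖) * (√c ^ n * ‖1 - β * r‖ ^ n) := by
        gcongr
        rw [inv_mul_eq_div, le_div_iff₀ (by linarith)]
        linarith
    _ = _ := by ring

theorem exists_norm_sum_flowCoeff_le {ι : Type*} (S : Finset ι) (c β : ι → ℂ)
    (hβ : ∀ i, ‖β i‖ < 1) {R : ℝ} (hR0 : 0 < R) (hR1 : R < 1) :
    ∃ ρ B : ℝ, 0 ≤ ρ ∧ ρ < 1 ∧ 0 ≤ B ∧ ∀ n : ℕ, ∀ r ∈ Set.Ioo (-R) R,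
      ‖∑ i ∈ S, c i * flowCoeff (β i) n r‖ ≤ B * ρ ^ n := by
  classical
  induction S using Finset.induction_on with
  | empty => exact ⟨0, 0, le_rfl, one_pos, le_rfl, by simp⟩
  | insert j S hj ih =>
    obtain ⟨ρ, B, h0, h1, hB, h⟩ := ih
    obtain ⟨ρ', B', h0', h1', hB', h'⟩ := exists_norm_flowCoeff_le (hβ j) hR0 hR1
    refine ⟨max ρ ρ', ‖c j‖ * B' + B, h0.trans (le_max_left _ _), max_lt h1 h1', by positivity,
      fun n r hr => ?_⟩
    rw [Finset.sum_insert hj, add_mul]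
    refine (norm_add_le _ _).trans (add_le_add ?_ ?_)
    · rw [norm_mul, mul_assoc]
      refine mul_le_mul_of_nonneg_left ((h' n r hr).trans ?_) (norm_nonneg _)
      gcongr
      exact le_max_right _ _
    · refine (h n r hr).trans ?_
      gcongr
      exact le_max_left _ _

namespace WeightedDirichlet

variable {ν : ℝ}

theorem sum_apply {ι : Type*} (S : Finset ι) (f : ι → WeightedDirichlet ν) (z : 𝔻) :
    (∑ i ∈ S, f i) z = ∑ i ∈ S, f i z := by
  let e : WeightedDirichlet ν →+ ℂ := ⟨⟨fun f => f z, rfl⟩, fun _ _ => rfl⟩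
  exact map_sum e f S

theorem coeff_sum {ι : Type*} (S : Finset ι) (f : ι → WeightedDirichlet ν) :
    coeff (∑ i ∈ S, f i) = ∑ i ∈ S, coeff (f i) := by
  let e : WeightedDirichlet ν →+ (ℕ → ℂ) := AddMonoidHom.mk' coeff coeff_add
  exact map_sum e f S

/-- The factor (1 + r τ z)⁻¹ sends a Cauchy kernel to a multiple of another one, whose coefficients
are τ ^ n times `flowCoeff`. The energy bound applies to finite combinations of kernels, since their
coefficients decay geometrically, and the rotations σ, τ do not change moduli. -/
theorem exists_weightedComposition {φ : 𝔻 → 𝔻} {σ τ : ℂ} (hσ : ‖σ‖ = 1) (hτ : ‖τ‖ = 1) {r : ℝ}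
    (h0 : 0 ≤ r) (h1 : r < 1) (hφ : ∀ z : 𝔻, (1 + r * τ * z) * (φ z : ℂ) = σ * (τ * z + r)) :
    ∃ T : WeightedDirichlet ν →L[ℂ] WeightedDirichlet ν,
      ∀ (f : WeightedDirichlet ν) (z : 𝔻), T f z = (1 + r * τ * z : ℂ)⁻¹ * f (φ z) := by
  -- Any R strictly between r and 1 would serve.
  set R := (1 + r) / 2 with hR
  have hR0 : 0 < R := by positivity
  have hR1 : R < 1 := by rw [hR]; linarith
  have hrR : r < R := by rw [hR]; linarith
  have hrmem : r ∈ Set.Ioo (-R) R := ⟨by linarith, hrR⟩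
  have hr1 : |r| < 1 := by rwa [abs_of_nonneg h0]
  obtain ⟨L, hL0, hL⟩ := exists_energy_bound (2 * ν) hR0 hR1
  refine exists_weightedComposition_of_dense _ φ _ dense_span_cauchyKernel √L fun f hf => ?_
  obtain ⟨l, rfl⟩ := Finsupp.mem_span_range_iff_exists_finsupp.1 hf
  set β : 𝔻 → ℂ := fun b => b * σ with hβdef
  have hβ : ∀ b, ‖β b‖ < 1 := fun b => by rw [hβdef]; simp [hσ, b.norm_lt_one]
  set v : ℕ → ℝ → ℂ := fun n r => ∑ b ∈ l.support, l b * flowCoeff (β b) n r with hv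
  obtain ⟨ρ, B, hρ0, hρ1, hB0, hB⟩ :=
    exists_norm_sum_flowCoeff_le l.support l β hβ hR0 hR1
  have hE := hL v (fun n x hx => ?_) ⟨ρ, B, hρ0, hρ1, hB⟩ r h0 hrR
  swap
  · have hx1 : |x| < 1 := (abs_lt.2 hx).trans hR1
    have := HasDerivAt.fun_sum (u := l.support) fun b _ =>
      (hasDerivAt_flowCoeff (hβ b) n hx1).const_mul (l b)
    refine this.congr_deriv ?_
    simp only [hv, Finset.mul_sum, ← Finset.sum_sub_distrib, ← Finset.sum_add_distrib,
      Finset.sum_div]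
    refine Finset.sum_congr rfl fun b _ => ?_
    ring
  have hf_apply : ∀ z : 𝔻, (l.sum fun b c => c • cauchyKernel ν b) z =
      ∑ b ∈ l.support, l b * (1 - b * z : ℂ)⁻¹ := fun z => by
    rw [Finsupp.sum, sum_apply]
    exact Finset.sum_congr rfl fun b _ => by rw [coe_smul, cauchyKernel_apply]
  have hf_coeff : ∀ n : ℕ, coeff (l.sum fun b c => c • cauchyKernel ν b) n =
      ∑ b ∈ l.support, l b * (b : ℂ) ^ n := fun n => by
    rw [Finsupp.sum, coeff_sum, Finset.sum_apply]
    exact Finset.sum_congr rfl fun b _ => by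
      rw [coeff_smul, Pi.smul_apply, coeff_cauchyKernel, smul_eq_mul]
  have hnv : ∀ n : ℕ, ‖τ ^ n * v n r‖ = ‖v n r‖ := fun n => by
    rw [norm_mul, norm_pow, hτ, one_pow, one_mul]
  have hv0 : ∀ n : ℕ, ‖v n 0‖ = ‖∑ b ∈ l.support, l b * (b : ℂ) ^ n‖ := fun n => by
    have : v n 0 = σ ^ n * ∑ b ∈ l.support, l b * (b : ℂ) ^ n := by
      rw [hv, Finset.mul_sum]
      refine Finset.sum_congr rfl fun b _ => ?_
      simp only [flowCoeff, hβdef, ofReal_zero, sub_zero, mul_zero, one_pow, div_one, mul_pow]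
      ring
    rw [this, norm_mul, norm_pow, hσ, one_pow, one_mul]
  have hs : Summable (fun n : ℕ => ‖τ ^ n * v n r‖ ^ 2 * ((n : ℝ) + 1) ^ (2 * ν)) := by
    refine Summable.of_nonneg_of_le (fun n => by positivity) (fun n => ?_)
      ((summable_rpow_mul_pow (2 * ν) (sq_nonneg ρ) (by nlinarith)).mul_left (B ^ 2))
    rw [hnv]
    calc ‖v n r‖ ^ 2 * ((n : ℝ) + 1) ^ (2 * ν)
        ≤ (B * ρ ^ n) ^ 2 * ((n : ℝ) + 1) ^ (2 * ν) := by
          gcongr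
          exact hB n r hrmem
      _ = _ := by ring
  obtain ⟨g, hg1, hg2⟩ := exists_of_hasSum
    (fun z : 𝔻 => (1 + r * τ * z : ℂ)⁻¹ * (l.sum fun b c => c • cauchyKernel ν b) (φ z))
    (fun n => τ ^ n * v n r) (fun z => by
      simp only [hf_apply, Finset.mul_sum, hv, Finset.sum_mul]
      refine hasSum_sum fun b _ => ?_
      have hne := one_sub_mul_ofReal_ne_zero (hβ b) hr1
      have hden : 1 + r * τ * (z : ℂ) ≠ 0 := by
        have := one_sub_mul_ofReal_ne_zero (β := -(τ * z)) (by
          rw [norm_neg, norm_mul, hτ, one_mul]; exact z.norm_lt_one) hr1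
        convert! this using 1
        ring
      have hq : ‖(β b - r) * (τ * z) / (1 - β b * r)‖ < 1 := by
        rw [norm_div, norm_mul, norm_mul, hτ, one_mul, div_lt_one (norm_pos_iff.2 hne)]
        refine lt_of_le_of_lt ?_ (norm_sub_ofReal_lt (hβ b) hr1)
        exact mul_le_of_le_one_right (norm_nonneg _) z.norm_lt_one.le
      have hne2 : (1 - β b * r) - (β b - r) * (τ * z) ≠ 0 := by
        intro h
        rw [← sub_eq_zero.1 h, div_self hne, norm_one] at hq
        exact lt_irrefl _ hq
      have key := (hasSum_geometric_of_norm_lt_one hq).mul_left (l b * (1 - β b * r)⁻¹)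
      have e1 : l b * (1 - β b * r)⁻¹ * (1 - (β b - r) * (τ * z) / (1 - β b * r))⁻¹ =
          (1 + r * τ * z : ℂ)⁻¹ * (l b * (1 - b * φ z : ℂ)⁻¹) := by
        have e2 : (1 + r * τ * z : ℂ) * (1 - b * φ z : ℂ) =
            (1 - β b * r) - (β b - r) * (τ * z) := by
          simp only [hβdef]
          linear_combination (-(b : ℂ)) * hφ z
        have e3 : (1 - β b * r) * (1 - (β b - r) * (τ * z) / (1 - β b * r)) =
            (1 - β b * r) - (β b - r) * (τ * z) := by
          field_simp
        rw [mul_assoc, ← mul_inv, e3, ← e2, mul_inv]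
        ring
      rw [e1] at key
      refine key.congr_fun fun n => ?_
      rw [flowCoeff, div_pow, mul_pow, mul_pow, pow_succ, div_eq_mul_inv, div_eq_mul_inv, mul_inv]
      ring) hs
  refine ⟨g, hg1, ?_⟩
  refine abs_le_of_sq_le_sq' ?_ (by positivity) |>.2
  rw [mul_pow, Real.sq_sqrt hL0, norm_sq_eq, norm_sq_eq, hg2]
  simp only [hnv, hf_coeff, ← hv0]
  exact hE

theorem exists_isCompositionOperator (ν : ℝ) {φ : 𝔻 → 𝔻} {σ τ : ℂ} (hσ : ‖σ‖ = 1) (hτ : ‖τ‖ = 1)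
    {r : ℝ} (h0 : 0 ≤ r) (h1 : r < 1)
    (hφ : ∀ z : 𝔻, (1 + r * τ * z) * (φ z : ℂ) = σ * (τ * z + r)) :
    ∃ C : WeightedDirichlet ν →L[ℂ] WeightedDirichlet ν, IsCompositionOperator φ C := by
  obtain ⟨T, hT⟩ := exists_weightedComposition (ν := ν) hσ hτ h0 h1 hφ
  obtain ⟨M, hM⟩ := exists_shift ν
  -- Multiplication by 1 + r τ z cancels the factor in T.
  refine ⟨(ContinuousLinearMap.id ℂ _ + ((r : ℂ) * τ) • M).comp T, fun f z => ?_⟩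
  have hden : 1 + r * τ * (z : ℂ) ≠ 0 := by
    have := one_sub_mul_ofReal_ne_zero (β := -(τ * z)) (by
      rw [norm_neg, norm_mul, hτ, one_mul]; exact z.norm_lt_one)
      (show |r| < 1 by rwa [abs_of_nonneg h0])
    convert! this using 1
    ring
  change (T f + ((r : ℂ) * τ) • M (T f)) z = f (φ z)
  rw [coe_add, coe_smul, hM, hT]
  field_simp

end WeightedDirichlet

/-! ### Geometry of the map with fixed points η, ζ and multiplier q. -/

theorem norm_sq_sub_real_mul {η ζ : ℂ} (hη : ‖η‖ = 1) (hζ : ‖ζ‖ = 1) (q : ℝ) :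
    ‖ζ - q * η‖ ^ 2 = (1 - q) ^ 2 + q * ‖ζ - η‖ ^ 2 := by
  have h1 : η.re * η.re + η.im * η.im = 1 := by
    rw [← normSq_apply, normSq_eq_norm_sq, hη, one_pow]
  have h2 : ζ.re * ζ.re + ζ.im * ζ.im = 1 := by
    rw [← normSq_apply, normSq_eq_norm_sq, hζ, one_pow]
  simp only [← normSq_eq_norm_sq, normSq_apply, sub_re, sub_im, mul_re, mul_im, ofReal_re,
    ofReal_im]
  linear_combination (q ^ 2 - q) * h1 + (1 - q) * h2

namespace HasMultiplier

variable {η ζ : ℂ} {q : ℝ} {φ : 𝔻 → 𝔻}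

theorem half_le_norm (hη : ‖η‖ = 1) (hζ : ‖ζ‖ = 1) (h0 : 0 < q) :
    ‖ζ - η‖ / 2 ≤ ‖ζ - q * η‖ := by
  refine le_of_sq_le_sq ?_ (norm_nonneg _)
  rw [norm_sq_sub_real_mul hη hζ]
  have h2 : ‖ζ - η‖ ≤ 2 := by
    have := norm_sub_le ζ η
    rw [hη, hζ] at this
    linarith
  have h4 : ‖ζ - η‖ ^ 2 ≤ 4 := by nlinarith [norm_nonneg (ζ - η)]
  have h5 := mul_nonneg (sq_nonneg (1 - q)) (sub_nonneg.2 h4)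
  nlinarith [mul_nonneg (sq_nonneg q) (sq_nonneg ‖ζ - η‖), mul_nonneg h0.le (sq_nonneg ‖ζ - η‖)]

theorem denom_ne_zero (hη : ‖η‖ = 1) (hζ : ‖ζ‖ = 1) (hne : ζ ≠ η) (h0 : 0 < q) :
    ζ - q * η ≠ 0 := by
  have h1 : 0 < ‖ζ - η‖ := norm_pos_iff.2 (sub_ne_zero.2 hne)
  exact norm_pos_iff.1 (lt_of_lt_of_le (by positivity) (half_le_norm hη hζ h0))

/-- The reciprocal of the pole of the linear fractional map with fixed points `η`, `ζ` and
multiplier `q`. -/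
noncomputable def pole (η ζ : ℂ) (q : ℝ) : ℂ := (1 - q) / (ζ - q * η)

theorem pole_mul (hη : ‖η‖ = 1) (hζ : ‖ζ‖ = 1) (hne : ζ ≠ η) (h0 : 0 < q) :
    pole η ζ q * (ζ - q * η) = 1 - q :=
  div_mul_cancel₀ _ (denom_ne_zero hη hζ hne h0)

theorem one_sub_norm_pole_sq (hη : ‖η‖ = 1) (hζ : ‖ζ‖ = 1) (hne : ζ ≠ η) (h0 : 0 < q) :
    1 - ‖pole η ζ q‖ ^ 2 = q * ‖ζ - η‖ ^ 2 / ‖ζ - q * η‖ ^ 2 := by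
  have h1 : ‖ζ - q * η‖ ≠ 0 := norm_ne_zero_iff.2 (denom_ne_zero hη hζ hne h0)
  have h2 : ‖(1 - q : ℂ)‖ ^ 2 = (1 - q) ^ 2 := by
    rw [← ofReal_one, ← ofReal_sub, norm_real, Real.norm_eq_abs, sq_abs]
  rw [pole, norm_div, div_pow, h2, eq_div_iff (pow_ne_zero 2 h1), sub_mul,
    div_mul_cancel₀ _ (pow_ne_zero 2 h1), norm_sq_sub_real_mul hη hζ]
  ring

/-- The pole approaches the circle no faster than q = μ ^ n. This rate determines the exponents in
both directions of the theorem. -/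
theorem le_one_sub_norm_pole_sq (hη : ‖η‖ = 1) (hζ : ‖ζ‖ = 1) (hne : ζ ≠ η) (h0 : 0 < q)
    (h1 : q ≤ 1) : q * (‖ζ - η‖ ^ 2 / 4) ≤ 1 - ‖pole η ζ q‖ ^ 2 := by
  rw [one_sub_norm_pole_sq hη hζ hne h0, mul_div_assoc]
  have h2 : ‖ζ - q * η‖ ≤ 2 := by
    have := norm_sub_le ζ (q * η)
    rw [norm_mul, norm_real, Real.norm_of_nonneg h0.le, hη, hζ] at this
    linarith
  have h3 : 0 < ‖ζ - q * η‖ := norm_pos_iff.2 (denom_ne_zero hη hζ hne h0)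
  gcongr
  nlinarith

/-- Since |φ(0)| equals the modulus of `pole`, this keeps φ^[n](0) away from 0, uniformly in n ≥ 1.
-/
theorem one_sub_norm_pole_sq_le (hη : ‖η‖ = 1) (hζ : ‖ζ‖ = 1) (hne : ζ ≠ η) (h0 : 0 < q)
    (h1 : q ≤ 1) : 1 - ‖pole η ζ q‖ ^ 2 ≤ 1 - (1 - q) ^ 2 / 4 := by
  have hE : ‖ζ - q * η‖ ≤ 2 := by
    have := norm_sub_le ζ (q * η)
    rw [norm_mul, norm_real, Real.norm_of_nonneg h0.le, hη, hζ] at this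
    linarith
  have hE2 : ‖ζ - q * η‖ ^ 2 ≤ 4 := by nlinarith [norm_nonneg (ζ - q * η)]
  have e := congrArg (fun x => ‖x‖ ^ 2) (pole_mul hη hζ hne h0)
  simp only [norm_mul, mul_pow] at e
  rw [← ofReal_one, ← ofReal_sub, norm_real, Real.norm_eq_abs, sq_abs] at e
  linarith [mul_le_mul_of_nonneg_left hE2 (sq_nonneg ‖pole η ζ q‖)]

theorem norm_pole_lt_one (hη : ‖η‖ = 1) (hζ : ‖ζ‖ = 1) (hne : ζ ≠ η) (h0 : 0 < q) (h1 : q ≤ 1) :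
    ‖pole η ζ q‖ < 1 := by
  have h2 := le_one_sub_norm_pole_sq hη hζ hne h0 h1
  have h3 : 0 < ‖ζ - η‖ := norm_pos_iff.2 (sub_ne_zero.2 hne)
  have h4 : 0 < q * (‖ζ - η‖ ^ 2 / 4) := by positivity
  nlinarith [norm_nonneg (pole η ζ q)]

theorem apply_sub_mul (h : HasMultiplier η ζ q φ) (hη : ‖η‖ = 1) (hζ : ‖ζ‖ = 1) (hne : ζ ≠ η)
    (h0 : 0 < q) (z : 𝔻) :
    ((φ z : ℂ) - η) * ((ζ - q * η) * (1 - pole η ζ q * z)) = q * (ζ - η) * (z - η) := by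
  have e := pole_mul hη hζ hne h0
  linear_combination (-((φ z : ℂ) - η) * z) * e - h z

theorem apply_mul (h : HasMultiplier η ζ q φ) (hη : ‖η‖ = 1) (hζ : ‖ζ‖ = 1) (hne : ζ ≠ η)
    (h0 : 0 < q) (z : 𝔻) :
    (φ z : ℂ) * ((ζ - q * η) * (1 - pole η ζ q * z)) =
      -(η * ζ * conj (ζ - q * η)) * (z - conj (pole η ζ q)) := by
  have e := pole_mul hη hζ hne h0
  have e1 : η * conj η = 1 := by rw [mul_conj', hη]; simp
  have e2 : ζ * conj ζ = 1 := by rw [mul_conj', hζ]; simp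
  have e3 : conj (pole η ζ q) * (conj ζ - q * conj η) = 1 - q := by
    have := congrArg conj e
    simpa using this
  simp only [map_sub, map_mul, conj_ofReal]
  linear_combination h.apply_sub_mul hη hζ hne h0 z - η * z * e + (-q * ζ * z) * e1 +
    (η * z) * e2 - (η * ζ) * e3

theorem exists_normal_form (h : HasMultiplier η ζ q φ) (hη : ‖η‖ = 1) (hζ : ‖ζ‖ = 1)
    (hne : ζ ≠ η) (h0 : 0 < q) (h1 : q < 1) :
    ∃ (σ τ : ℂ) (r : ℝ), ‖σ‖ = 1 ∧ ‖τ‖ = 1 ∧ 0 ≤ r ∧ r < 1 ∧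
      ∀ z : 𝔻, (1 + r * τ * z) * (φ z : ℂ) = σ * (τ * z + r) := by
  have hE := denom_ne_zero hη hζ hne h0
  set E := ζ - q * η with hEdef
  set a := pole η ζ q with ha
  have ha0 : a ≠ 0 := by
    refine div_ne_zero ?_ hE
    rw [← ofReal_one, ← ofReal_sub, ofReal_ne_zero]
    linarith
  have hna : (‖a‖ : ℂ) ≠ 0 := by rwa [ofReal_ne_zero, norm_ne_zero_iff]
  have hEn : ‖E‖ ≠ 0 := norm_ne_zero_iff.2 hE
  have han : ‖a‖ ≠ 0 := norm_ne_zero_iff.2 ha0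
  have haa : a * conj a = (‖a‖ : ℂ) ^ 2 := mul_conj' a
  refine ⟨η * ζ * conj E / E * (conj a / ‖a‖), -a / ‖a‖, ‖a‖, ?_, ?_, norm_nonneg _,
    norm_pole_lt_one hη hζ hne h0 h1.le, fun z => ?_⟩
  · simp only [norm_mul, norm_div, RCLike.norm_conj, hη, hζ, norm_real, norm_norm]
    field_simp
  · rw [norm_div, norm_neg, norm_real, norm_norm, div_self han]
  · have e := h.apply_mul hη hζ hne h0 z
    rw [← hEdef, ← ha] at e
    have e1 : (‖a‖ : ℂ) * (-a / ‖a‖) = -a := by field_simp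
    have e2 : conj a / (‖a‖ : ℂ) * (-a / ‖a‖ * z + ‖a‖) = -(z - conj a) := by
      field_simp
      linear_combination (-(z : ℂ)) * haa
    rw [e1, mul_assoc _ (conj a / _), e2]
    field_simp
    linear_combination e

theorem norm_apply_zero (h : HasMultiplier η ζ q φ) (hη : ‖η‖ = 1) (hζ : ‖ζ‖ = 1)
    (hne : ζ ≠ η) (h0 : 0 < q) : ‖(φ 0 : ℂ)‖ = ‖pole η ζ q‖ := by
  have e := congrArg norm (h.apply_mul hη hζ hne h0 0)
  simp only [UnitDisc.coe_zero, mul_zero, sub_zero, mul_one, zero_sub, norm_mul, norm_neg,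
    RCLike.norm_conj, hη, hζ, one_mul] at e
  refine mul_right_cancel₀ (norm_ne_zero_iff.2 (denom_ne_zero hη hζ hne h0)) (e.trans ?_)
  ring

end HasMultiplier

/-! ### Sufficiency: dense sets of vectors with orbits tending to zero. -/

theorem Nat.add_choose_le_pow (n k : ℕ) : (n + k).choose k ≤ (n + 1) ^ k := by
  induction k with
  | zero => simp
  | succ k ih =>
    have h := Nat.add_one_mul_choose_eq (n + k) k
    refine Nat.le_of_mul_le_mul_right ?_ (by positivity : 0 < k + 1)
    rw [← add_assoc]
    change (n + k + 1).choose (k + 1) * (k + 1) ≤ _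
    rw [← h, pow_succ]
    calc (n + k + 1) * (n + k).choose k ≤ ((n + 1) * (k + 1)) * (n + 1) ^ k := by
          gcongr
          nlinarith
      _ = _ := by ring

/-- An invertible operator with dense sets of vectors whose forward, respectively backward, orbits
tend to zero is recurrent. -/
theorem isRecurrent_of_dense {H : Type*} [NormedAddCommGroup H] [InnerProductSpace ℂ H]
    [CompleteSpace H] (T S : H →L[ℂ] H) (hTS : ∀ x, T (S x) = x)
    (hX : Dense {x : H | Tendsto (fun n : ℕ => (T ^ n) x) atTop (𝓝 0)})
    (hY : Dense {x : H | Tendsto (fun n : ℕ => (S ^ n) x) atTop (𝓝 0)}) : IsRecurrent T := by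
  intro U hU hne
  obtain ⟨x, hxU, hx⟩ := hX.inter_open_nonempty U hU hne
  obtain ⟨y, hyU, hy⟩ := hY.inter_open_nonempty U hU hne
  -- The vector x + S ^ n y is close to x, and T ^ n sends it to T ^ n x + y, which is close to y;
  -- both x and y lie in U.
  have h1 : Tendsto (fun n : ℕ => x + (S ^ n) y) atTop (𝓝 x) := by
    simpa using (tendsto_const_nhds (x := x)).add hy
  have h2 : Tendsto (fun n : ℕ => (T ^ n) x + y) atTop (𝓝 y) := by
    simpa using Tendsto.add hx (tendsto_const_nhds (x := y))
  obtain ⟨n, ⟨hn1, hn2⟩, hn⟩ := ((h1.eventually (hU.mem_nhds hxU)).and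
    (h2.eventually (hU.mem_nhds hyU)) |>.and (eventually_gt_atTop 0)).exists
  refine ⟨n, hn, (T ^ n) x + y, ⟨_, hn1, ?_⟩, hn2⟩
  rw [map_add]
  congr 1
  simp only [FunLike.coe_pow_eq_iterate]
  exact LeftInverse.iterate hTS n y

namespace WeightedDirichlet

variable {ν : ℝ}

/-- The coefficients are binomials of size at most (n + 1) ^ k times a ^ n, so the squared norm is a
power sum with exponent 2k + 2ν, nonnegative by `hk`. -/
theorem exists_inv_one_sub_pow (ν : ℝ) (k : ℕ) (hk : 0 ≤ 2 * (k : ℝ) + 2 * ν) :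
    ∃ K : ℝ, 0 < K ∧ ∀ a : ℂ, ‖a‖ < 1 → ∃ e : WeightedDirichlet ν,
      (∀ z : 𝔻, e z = ((1 - a * z : ℂ) ^ (k + 1))⁻¹) ∧
      ‖e‖ ≤ K * (1 - ‖a‖ ^ 2) ^ (-((k : ℝ) + ν + 1 / 2)) := by
  obtain ⟨C, hC, hCr⟩ := exists_tsum_rpow_mul_pow_le hk
  refine ⟨√C, Real.sqrt_pos.2 hC, fun a ha => ?_⟩
  have ha2 : ‖a‖ ^ 2 < 1 := by nlinarith [norm_nonneg a]
  obtain ⟨hs, hle⟩ := hCr (‖a‖ ^ 2) (sq_nonneg _) ha2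
  have hterm : ∀ n : ℕ, ‖((n + k).choose k : ℂ) * a ^ n‖ ^ 2 * ((n : ℝ) + 1) ^ (2 * ν) ≤
      ((n : ℝ) + 1) ^ (2 * (k : ℝ) + 2 * ν) * (‖a‖ ^ 2) ^ n := by
    intro n
    have h1 : (((n + k).choose k : ℕ) : ℝ) ≤ ((n : ℝ) + 1) ^ k := by
      exact_mod_cast Nat.add_choose_le_pow n k
    have h2 : ((n : ℝ) + 1) ^ (2 * (k : ℝ)) = (((n : ℝ) + 1) ^ k) ^ 2 := by
      rw [← pow_mul, ← Real.rpow_natCast]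
      push_cast
      ring_nf
    rw [norm_mul, norm_pow, Complex.norm_natCast, Real.rpow_add (by positivity), h2, mul_pow]
    calc (((n + k).choose k : ℕ) : ℝ) ^ 2 * (‖a‖ ^ n) ^ 2 * ((n : ℝ) + 1) ^ (2 * ν)
        ≤ (((n : ℝ) + 1) ^ k) ^ 2 * (‖a‖ ^ n) ^ 2 * ((n : ℝ) + 1) ^ (2 * ν) := by gcongr
      _ = _ := by ring
  have hs' := Summable.of_nonneg_of_le (fun n => by positivity) hterm hs
  obtain ⟨e, he1, he2⟩ := exists_of_hasSum (fun z : 𝔻 => ((1 - a * z : ℂ) ^ (k + 1))⁻¹)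
    (fun n => ((n + k).choose k : ℂ) * a ^ n) (fun z => by
      have hz : ‖a * (z : ℂ)‖ < 1 := by
        rw [norm_mul]
        nlinarith [norm_nonneg a, z.norm_lt_one, norm_nonneg (z : ℂ)]
      simpa only [mul_pow, one_div, mul_assoc] using
        hasSum_choose_mul_geometric_of_norm_lt_one k hz) hs'
  refine ⟨e, he1, ?_⟩
  have hpos : 0 < 1 - ‖a‖ ^ 2 := by linarith
  refine abs_le_of_sq_le_sq' ?_ (by positivity) |>.2
  rw [mul_pow, Real.sq_sqrt hC.le, norm_sq_eq, he2, ← Real.rpow_natCast, ← Real.rpow_mul hpos.le]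
  refine (hs'.tsum_le_tsum hterm hs).trans (hle.trans_eq ?_)
  congr 2
  push_cast
  ring

theorem iterate_apply {φ : 𝔻 → 𝔻} {C : WeightedDirichlet ν →L[ℂ] WeightedDirichlet ν}
    (hC : IsCompositionOperator φ C) (n : ℕ) (f : WeightedDirichlet ν) (z : 𝔻) :
    (C ^ n) f z = f (φ^[n] z) := by
  induction n generalizing z with
  | zero => rfl
  | succ n ih =>
    rw [pow_succ', mul_apply_eq_comp, hC, ih, ← iterate_succ_apply]

theorem pow_apply_of_mul {A : WeightedDirichlet ν →L[ℂ] WeightedDirichlet ν} {m : 𝔻 → ℂ}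
    (hA : ∀ (f : WeightedDirichlet ν) (z : 𝔻), A f z = m z * f z) (n : ℕ)
    (f : WeightedDirichlet ν) (z : 𝔻) : (A ^ n) f z = m z ^ n * f z := by
  induction n with
  | zero => simp
  | succ n ih => rw [pow_succ', mul_apply_eq_comp, hA, ih, pow_succ]; ring

theorem cauchyKernel_zero_apply (z : 𝔻) : cauchyKernel ν 0 z = 1 := by
  rw [cauchyKernel_apply, UnitDisc.coe_zero, zero_mul, sub_zero, inv_one]

/-- With q = μ ^ n one has φ^[n](z) - η = c (z - η) / (1 - a z) with |c| ≤ 2q and 1 - |a| ^ 2 of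
order at least q. The power k + 1 yields q ^ (k + 1) · q ^ (-(k + ν + 1/2)) = q ^ (1/2 - ν),
independently of k. -/
theorem exists_norm_pow_apply_le {η ζ : ℂ} {μ : ℝ} {φ : 𝔻 → 𝔻} (h : HasMultiplier η ζ μ φ)
    (hη : ‖η‖ = 1) (hζ : ‖ζ‖ = 1) (hne : ζ ≠ η) (h0 : 0 < μ) (h1 : μ < 1)
    {C A : WeightedDirichlet ν →L[ℂ] WeightedDirichlet ν} (hC : IsCompositionOperator φ C)
    (hA : ∀ (f : WeightedDirichlet ν) (z : 𝔻), A f z = (z - η) * f z)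
    (k : ℕ) (hk : 0 ≤ 2 * (k : ℝ) + 2 * ν) :
    ∃ K : ℝ, ∀ n : ℕ, ‖(C ^ n) ((A ^ (k + 1)) (cauchyKernel ν 0))‖ ≤
      K * (μ ^ (1 / 2 - ν)) ^ n := by
  obtain ⟨K, hK, hKa⟩ := exists_inv_one_sub_pow ν k hk
  have hδ : 0 < ‖ζ - η‖ := norm_pos_iff.2 (sub_ne_zero.2 hne)
  refine ⟨‖A ^ (k + 1)‖ * (2 ^ (k + 1) * (K * (‖ζ - η‖ ^ 2 / 4) ^ (-((k : ℝ) + ν + 1 / 2)))),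
    fun n => ?_⟩
  set q := μ ^ n with hq
  have hq0 : 0 < q := pow_pos h0 n
  have hq1 : q ≤ 1 := pow_le_one₀ h0.le h1.le
  have hmul : HasMultiplier η ζ q φ^[n] := h.iterate hζ n
  have hE := HasMultiplier.denom_ne_zero hη hζ hne hq0
  have hp1 := HasMultiplier.norm_pole_lt_one hη hζ hne hq0 hq1
  obtain ⟨e, he1, he2⟩ := hKa _ hp1
  set a := HasMultiplier.pole η ζ q with ha
  set c : ℂ := q * (ζ - η) / (ζ - q * η) with hc
  have heq : (C ^ n) ((A ^ (k + 1)) (cauchyKernel ν 0)) = (A ^ (k + 1)) (c ^ (k + 1) • e) := by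
    refine ext_apply fun z => ?_
    rw [iterate_apply hC, pow_apply_of_mul hA, pow_apply_of_mul hA, cauchyKernel_zero_apply,
      coe_smul, he1, mul_one, ← mul_assoc, ← mul_pow, ← div_eq_mul_inv, ← div_pow]
    congr 1
    have hz : 1 - a * (z : ℂ) ≠ 0 := by
      intro hz
      have h2 : ‖a * (z : ℂ)‖ = 1 := by rw [← sub_eq_zero.1 hz, norm_one]
      rw [norm_mul] at h2
      nlinarith [norm_nonneg a, z.norm_lt_one, norm_nonneg (z : ℂ)]
    have e1 := hmul.apply_sub_mul hη hζ hne hq0 z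
    rw [← ha] at e1
    rw [eq_div_iff hz, hc, ← mul_div_assoc, eq_div_iff hE]
    linear_combination e1
  rw [heq]
  refine ((A ^ (k + 1)).le_opNorm _).trans ?_
  rw [mul_assoc]
  refine mul_le_mul_of_nonneg_left ?_ (norm_nonneg _)
  have hc1 : ‖c‖ ≤ 2 * q := by
    have h2 := HasMultiplier.half_le_norm hη hζ hq0
    rw [hc, norm_div, norm_mul, norm_real, Real.norm_of_nonneg hq0.le,
      div_le_iff₀ (norm_pos_iff.2 hE)]
    nlinarith
  have he3 : ‖e‖ ≤ K * (q * (‖ζ - η‖ ^ 2 / 4)) ^ (-((k : ℝ) + ν + 1 / 2)) := by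
    refine he2.trans (mul_le_mul_of_nonneg_left ?_ hK.le)
    exact Real.rpow_le_rpow_of_nonpos (by positivity)
      (HasMultiplier.le_one_sub_norm_pole_sq hη hζ hne hq0 hq1) (by linarith)
  rw [norm_smul, norm_pow]
  calc ‖c‖ ^ (k + 1) * ‖e‖
      ≤ (2 * q) ^ (k + 1) * (K * (q * (‖ζ - η‖ ^ 2 / 4)) ^ (-((k : ℝ) + ν + 1 / 2))) := by
        gcongr
    _ = 2 ^ (k + 1) * (K * (‖ζ - η‖ ^ 2 / 4) ^ (-((k : ℝ) + ν + 1 / 2))) *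
        (q ^ (k + 1) * q ^ (-((k : ℝ) + ν + 1 / 2))) := by
        rw [Real.mul_rpow hq0.le (by positivity)]
        ring
    _ = _ := by
        congr 1
        rw [← Real.rpow_natCast q, ← Real.rpow_add hq0, hq, ← Real.rpow_natCast μ,
          ← Real.rpow_mul h0.le, ← Real.rpow_natCast, ← Real.rpow_mul h0.le]
        congr 1
        push_cast
        ring

theorem coeff_shift_pow {M : WeightedDirichlet ν →L[ℂ] WeightedDirichlet ν}
    (hM : ∀ (f : WeightedDirichlet ν) (z : 𝔻), M f z = z * f z) (n : ℕ) :
    coeff ((M ^ n) (cauchyKernel ν 0)) = Pi.single n 1 := by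
  refine (coeff_unique _ _ fun z => ?_).symm
  rw [pow_apply_of_mul hM, cauchyKernel_zero_apply, mul_one]
  have h := hasSum_single (f := fun m => (Pi.single n 1 : ℕ → ℂ) m * (z : ℂ) ^ m) n
    fun m hm => by simp [Pi.single_eq_of_ne hm]
  simpa using h

theorem inner_shift_pow {M : WeightedDirichlet ν →L[ℂ] WeightedDirichlet ν}
    (hM : ∀ (f : WeightedDirichlet ν) (z : 𝔻), M f z = z * f z) (n : ℕ)
    (f : WeightedDirichlet ν) :
    inner ℂ f ((M ^ n) (cauchyKernel ν 0)) =
      conj (coeff f n) * (((n : ℝ) + 1) ^ (2 * ν) : ℝ) := by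
  rw [inner_def, coeff_shift_pow hM, tsum_eq_single n fun m hm => by
    simp [Pi.single_eq_of_ne hm]]
  simp

theorem eq_zero_of_inner_shift_pow {M : WeightedDirichlet ν →L[ℂ] WeightedDirichlet ν}
    (hM : ∀ (f : WeightedDirichlet ν) (z : 𝔻), M f z = z * f z) {f : WeightedDirichlet ν}
    (h : ∀ n : ℕ, inner ℂ f ((M ^ n) (cauchyKernel ν 0)) = 0) : f = 0 := by
  refine eq_zero_of_coeff f fun n => ?_
  have h1 := h n
  rw [inner_shift_pow hM] at h1
  have h2 : ((((n : ℝ) + 1) ^ (2 * ν) : ℝ) : ℂ) ≠ 0 := by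
    rw [ofReal_ne_zero]; positivity
  simpa [h2] using h1

/-- A vector f orthogonal to the range has pairings with zⁿ of constant modulus, so ‖f‖ ^ 2 is that
modulus squared times ∑ (n + 1) ^ (-2ν), which diverges for ν ≤ 1/2 unless the modulus is 0. -/
theorem denseRange_shift_sub (hν : ν ≤ 1 / 2) {η : ℂ} (hη : ‖η‖ = 1)
    {M A : WeightedDirichlet ν →L[ℂ] WeightedDirichlet ν}
    (hM : ∀ (f : WeightedDirichlet ν) (z : 𝔻), M f z = z * f z) (hA : ∀ f, A f = M f - η • f) :
    DenseRange A := by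
  have hd : Dense (LinearMap.range (A : WeightedDirichlet ν →ₗ[ℂ] WeightedDirichlet ν) :
      Set (WeightedDirichlet ν)) := by
    rw [Submodule.dense_iff_topologicalClosure_eq_top, Submodule.topologicalClosure_eq_top_iff,
      Submodule.eq_bot_iff]
    intro f hf
    have h1 : ∀ g, inner ℂ f (M g) = η * inner ℂ f g := by
      intro g
      have : inner ℂ f (A g) = 0 := (Submodule.mem_orthogonal' _ _).1 hf _ ⟨g, rfl⟩
      rw [hA, inner_sub_right, inner_smul_right] at this
      exact sub_eq_zero.1 this
    set x : ℕ → ℂ := fun n => inner ℂ f ((M ^ n) (cauchyKernel ν 0)) with hx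
    have h2 : ∀ n, ‖x n‖ = ‖x 0‖ := by
      intro n
      induction n with
      | zero => rfl
      | succ n ih =>
        rw [← ih, hx]
        simp only
        rw [pow_succ', mul_apply_eq_comp, h1, norm_mul, hη, one_mul]
    have h3 : ‖x 0‖ = 0 := by
      by_contra hne
      have hpos : 0 < ‖x 0‖ ^ 2 := by positivity
      have h4 : ∀ n : ℕ, ‖x 0‖ ^ 2 * (1 / (((n + 1 : ℕ) : ℝ))) ≤
          ‖coeff f n‖ ^ 2 * ((n : ℝ) + 1) ^ (2 * ν) := by
        intro n
        have hw : 0 < ((n : ℝ) + 1) ^ (2 * ν) := by positivity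
        have e1 : ‖x 0‖ = ‖coeff f n‖ * ((n : ℝ) + 1) ^ (2 * ν) := by
          rw [← h2 n, hx]
          simp only
          rw [inner_shift_pow hM, norm_mul, RCLike.norm_conj, norm_real,
            Real.norm_of_nonneg hw.le]
        have e2 : ((n : ℝ) + 1) ^ (2 * ν) ≤ (n : ℝ) + 1 := by
          have := Real.rpow_le_rpow_of_exponent_le
            (by linarith [n.cast_nonneg (α := ℝ)] : 1 ≤ (n : ℝ) + 1) (by linarith : 2 * ν ≤ 1)
          rwa [Real.rpow_one] at this
        rw [e1, Nat.cast_add_one, mul_one_div, div_le_iff₀ (by positivity), mul_pow, sq (_ ^ _)]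
        have := mul_le_mul_of_nonneg_left e2
          (by positivity : 0 ≤ ‖coeff f n‖ ^ 2 * ((n : ℝ) + 1) ^ (2 * ν))
        linarith
      have h5 := Summable.of_nonneg_of_le (fun n => by positivity) h4 (summable_coeff f)
      rw [summable_mul_left_iff hpos.ne'] at h5
      exact Real.not_summable_one_div_natCast
        ((summable_nat_add_iff (f := fun n : ℕ => 1 / (n : ℝ)) 1).1 h5)
    exact eq_zero_of_inner_shift_pow hM fun n => norm_eq_zero.1 ((h2 n).trans h3)
  exact hd

/-- The powers of z - η span the polynomials, which are dense. Multiplication by (z - η) ^ m has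
dense range, so the polynomials divisible by it are dense too. -/
theorem dense_of_shift_sub_pow_mem (hν : ν ≤ 1 / 2) {η : ℂ} (hη : ‖η‖ = 1)
    {M A : WeightedDirichlet ν →L[ℂ] WeightedDirichlet ν}
    (hM : ∀ (f : WeightedDirichlet ν) (z : 𝔻), M f z = z * f z) (hA : ∀ f, A f = M f - η • f)
    (X : Submodule ℂ (WeightedDirichlet ν)) (m : ℕ)
    (hX : ∀ i, m ≤ i → (A ^ i) (cauchyKernel ν 0) ∈ X) : Dense (X : Set (WeightedDirichlet ν)) := by
  set P := Submodule.span ℂ (Set.range fun i : ℕ => (A ^ i) (cauchyKernel ν 0)) with hP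
  have hAP : ∀ f ∈ P, A f ∈ P := by
    intro f hf
    have : P ≤ P.comap (A : WeightedDirichlet ν →ₗ[ℂ] WeightedDirichlet ν) := by
      rw [hP, Submodule.span_le]
      rintro _ ⟨i, rfl⟩
      refine Submodule.subset_span ⟨i + 1, ?_⟩
      simp only
      rw [pow_succ', mul_apply_eq_comp]
      rfl
    exact this hf
  have hMP : ∀ n : ℕ, (M ^ n) (cauchyKernel ν 0) ∈ P := by
    intro n
    induction n with
    | zero => exact Submodule.subset_span ⟨0, rfl⟩
    | succ n ih =>
      rw [pow_succ', mul_apply_eq_comp, ← sub_add_cancel (M _) (η • _), ← hA]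
      exact P.add_mem (hAP _ ih) (P.smul_mem _ ih)
  have hPd : Dense (P : Set (WeightedDirichlet ν)) := by
    rw [Submodule.dense_iff_topologicalClosure_eq_top, Submodule.topologicalClosure_eq_top_iff,
      Submodule.eq_bot_iff]
    exact fun f hf => eq_zero_of_inner_shift_pow hM fun n =>
      (Submodule.mem_orthogonal' _ _).1 hf _ (hMP n)
  have hdr : DenseRange (A ^ m) := by
    rw [FunLike.coe_pow_eq_iterate]
    clear hX
    induction m with
    | zero => exact denseRange_id
    | succ m ih =>
      rw [iterate_succ']
      exact (denseRange_shift_sub hν hη hM hA).comp ih A.continuous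
  refine (hdr.dense_image (A ^ m).continuous hPd).mono ?_
  rintro _ ⟨f, hf, rfl⟩
  have : P ≤ X.comap ((A ^ m : WeightedDirichlet ν →L[ℂ] WeightedDirichlet ν) :
      WeightedDirichlet ν →ₗ[ℂ] WeightedDirichlet ν) := by
    rw [hP, Submodule.span_le]
    rintro _ ⟨i, rfl⟩
    change (A ^ m) ((A ^ i) (cauchyKernel ν 0)) ∈ X
    rw [← mul_apply_eq_comp, ← pow_add]
    exact hX _ (Nat.le_add_right m i)
  exact this hf

theorem dense_tendsto_zero (hν : ν ≤ 1 / 2) {η ζ : ℂ} {μ : ℝ} {φ : 𝔻 → 𝔻}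
    (h : HasMultiplier η ζ μ φ) (hη : ‖η‖ = 1) (hζ : ‖ζ‖ = 1) (hne : ζ ≠ η) (h0 : 0 < μ)
    (h1 : μ < 1) {C : WeightedDirichlet ν →L[ℂ] WeightedDirichlet ν}
    (hC : IsCompositionOperator φ C) {c : ℂ} (hc : ‖c‖ * μ ^ (1 / 2 - ν) < 1) :
    Dense {f : WeightedDirichlet ν | Tendsto (fun n : ℕ => ((c • C) ^ n) f) atTop (𝓝 0)} := by
  obtain ⟨M, hM⟩ := exists_shift ν
  set A : WeightedDirichlet ν →L[ℂ] WeightedDirichlet ν :=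
    M - η • ContinuousLinearMap.id ℂ _ with hAdef
  have hA : ∀ f, A f = M f - η • f := fun f => rfl
  have hA' : ∀ (f : WeightedDirichlet ν) (z : 𝔻), A f z = (z - η) * f z := by
    intro f z
    have e : M f = A f + η • f := by rw [hA, sub_add_cancel]
    have e2 := hM f z
    rw [e, coe_add, coe_smul] at e2
    linear_combination e2
  let X : Submodule ℂ (WeightedDirichlet ν) :=
    { carrier := {f | Tendsto (fun n : ℕ => ((c • C) ^ n) f) atTop (𝓝 0)}
      zero_mem' := by
        simp only [Set.mem_ofPred_eq, map_zero]
        exact tendsto_const_nhds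
      add_mem' := fun {f g} hf hg => by
        simp only [Set.mem_ofPred_eq, map_add] at hf hg ⊢
        simpa using hf.add hg
      smul_mem' := fun a f hf => by
        simp only [Set.mem_ofPred_eq, map_smul] at hf ⊢
        simpa using hf.const_smul a }
  -- Powers of z - η beyond k0 satisfy k ≥ -ν, as the norm estimate requires.
  obtain ⟨k0, hk0⟩ := exists_nat_ge (-ν)
  refine dense_of_shift_sub_pow_mem hν hη hM hA X (k0 + 1) fun i hi => ?_
  obtain ⟨k, rfl⟩ : ∃ k, i = k + 1 := ⟨i - 1, by omega⟩
  have hk : (k0 : ℝ) ≤ k := by exact_mod_cast Nat.le_of_succ_le_succ hi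
  obtain ⟨K, hK⟩ := exists_norm_pow_apply_le h hη hζ hne h0 h1 hC hA' k (by linarith)
  change Tendsto _ _ _
  have hlim : Tendsto (fun n : ℕ => K * (‖c‖ * μ ^ (1 / 2 - ν)) ^ n) atTop (𝓝 0) := by
    simpa using (tendsto_pow_atTop_nhds_zero_of_lt_one (by positivity) hc).const_mul K
  refine squeeze_zero_norm (fun n => ?_) hlim
  rw [smul_pow, smul_apply, norm_smul, norm_pow, mul_pow]
  have := mul_le_mul_of_nonneg_left (hK n) (pow_nonneg (norm_nonneg c) n)
  linarith

end WeightedDirichlet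

/-! ### Necessity: derivatives at the origin obstruct recurrence. -/

namespace WeightedDirichlet

variable {ν : ℝ}

/-- The derivative at a point of the disk is a bounded functional, with the natural growth of its
norm at the boundary. -/
theorem exists_deriv_functional (ν : ℝ) : ∃ K : ℝ, 0 < K ∧ ∀ w : ℂ, ‖w‖ < 1 →
    ∃ k : WeightedDirichlet ν, ‖k‖ ≤ K * (1 - ‖w‖ ^ 2) ^ (-(1 + max 0 (1 / 2 - ν))) ∧
      ∀ f : WeightedDirichlet ν,
        HasSum (fun n : ℕ => (n * w ^ (n - 1)) * coeff f n) (inner ℂ k f) := by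
  set γ := max 0 (1 / 2 - ν) with hγ
  have hγ0 : 0 ≤ γ := le_max_left _ _
  -- The dual weight is at most (n + 1) ^ (2γ - 1), so with the factor n ^ 2 the power sum has
  -- exponent 1 + 2γ > 0 and produces no logarithm, even at ν = 1/2.
  have hγν : -(2 * ν) ≤ 2 * γ - 1 := by linarith [le_max_right 0 (1 / 2 - ν)]
  obtain ⟨C, hC, hCr⟩ := exists_tsum_rpow_mul_pow_le (s := 1 + 2 * γ) (by positivity)
  obtain ⟨B, hB, hBn⟩ := exists_weight_diff_le (2 * γ - 1)
  refine ⟨√(B * C), by positivity, fun w hw => ?_⟩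
  have hw2 : ‖w‖ ^ 2 < 1 := by nlinarith [norm_nonneg w]
  have hpos : 0 < 1 - ‖w‖ ^ 2 := by linarith
  obtain ⟨hs, hle⟩ := hCr (‖w‖ ^ 2) (sq_nonneg _) hw2
  set l : ℕ → ℂ := fun n => n * w ^ (n - 1) with hl
  have hterm : ∀ n : ℕ, ‖l (n + 1)‖ ^ 2 * (((n + 1 : ℕ) : ℝ) + 1) ^ (-(2 * ν)) ≤
      B * (((n : ℝ) + 1) ^ (1 + 2 * γ) * (‖w‖ ^ 2) ^ n) := by
    intro n
    have e1 : (((n + 1 : ℕ) : ℝ) + 1) ^ (-(2 * ν)) ≤ B * ((n : ℝ) + 1) ^ (2 * γ - 1) := by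
      refine le_trans ?_ (hBn n).2.2
      refine Real.rpow_le_rpow_of_exponent_le ?_ hγν
      linarith [(n + 1).cast_nonneg (α := ℝ)]
    have e2 : ((n : ℝ) + 1) ^ (1 + 2 * γ) = ((n : ℝ) + 1) ^ 2 * ((n : ℝ) + 1) ^ (2 * γ - 1) := by
      rw [← Real.rpow_natCast, ← Real.rpow_add (by positivity)]
      congr 1
      push_cast
      ring
    have e3 : ‖l (n + 1)‖ ^ 2 = ((n : ℝ) + 1) ^ 2 * (‖w‖ ^ 2) ^ n := by
      rw [hl]
      simp only
      rw [norm_mul, Complex.norm_natCast, norm_pow, Nat.add_sub_cancel, Nat.cast_add_one]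
      ring
    rw [e2, e3]
    calc ((n : ℝ) + 1) ^ 2 * (‖w‖ ^ 2) ^ n * (((n + 1 : ℕ) : ℝ) + 1) ^ (-(2 * ν))
        ≤ ((n : ℝ) + 1) ^ 2 * (‖w‖ ^ 2) ^ n * (B * ((n : ℝ) + 1) ^ (2 * γ - 1)) := by gcongr
      _ = _ := by ring
  have hs1 := Summable.of_nonneg_of_le (fun n => by positivity) hterm (hs.mul_left B)
  have hls : Summable (fun n : ℕ => ‖l n‖ ^ 2 * ((n : ℝ) + 1) ^ (-(2 * ν))) :=
    (summable_nat_add_iff 1).1 hs1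
  obtain ⟨k, hk1, hk2⟩ := exists_hasSum_mul_coeff_inner l hls
  refine ⟨k, ?_, hk2⟩
  refine abs_le_of_sq_le_sq' ?_ (by positivity) |>.2
  have hl0 : l 0 = 0 := by simp [hl]
  rw [hk1, hls.tsum_eq_zero_add, hl0, norm_zero, zero_pow two_ne_zero, zero_mul, zero_add,
    mul_pow, Real.sq_sqrt (by positivity), ← Real.rpow_natCast, ← Real.rpow_mul hpos.le]
  refine (hs1.tsum_le_tsum hterm (hs.mul_left B)).trans ?_
  rw [tsum_mul_left, mul_assoc]
  refine mul_le_mul_of_nonneg_left (hle.trans_eq ?_) hB.le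
  congr 2
  push_cast
  ring

/-- The analytic function on the plane given by the Taylor series of an element of `S_ν`. -/
noncomputable def extend (f : WeightedDirichlet ν) (w : ℂ) : ℂ := ∑' n : ℕ, coeff f n * w ^ n

theorem extend_coe (f : WeightedDirichlet ν) (z : 𝔻) : extend f z = f z := (hasSum_coeff f z).tsum_eq

theorem hasDerivAt_extend (f : WeightedDirichlet ν) {w : ℂ} (hw : ‖w‖ < 1) :
    HasDerivAt (extend f) (∑' n : ℕ, n * w ^ (n - 1) * coeff f n) w := by
  obtain ⟨K, -, hK⟩ := exists_deriv_functional ν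
  obtain ⟨ρ, hρ1, hρ2⟩ := exists_between hw
  have hρ0 : 0 < ρ := (norm_nonneg w).trans_lt hρ1
  have hρn : ‖(ρ : ℂ)‖ = ρ := by rw [norm_real, Real.norm_of_nonneg hρ0.le]
  obtain ⟨k, -, hk⟩ := hK (ρ : ℂ) (by rwa [hρn])
  refine hasDerivAt_tsum_of_isPreconnected (t := Metric.ball 0 ρ) (y₀ := 0)
    (g := fun n w => coeff f n * w ^ n) (g' := fun n w => n * w ^ (n - 1) * coeff f n)
    (hk f).summable.norm Metric.isOpen_ball (convex_ball _ _).isPreconnected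
    (fun n y hy => ?_) (fun n y hy => ?_) (Metric.mem_ball_self hρ0) ?_ (by simpa using hρ1)
  · have := (hasDerivAt_pow n y).const_mul (coeff f n)
    refine this.congr_deriv ?_
    ring
  · simp only [norm_mul, norm_pow, hρn]
    have : ‖y‖ ≤ ρ := (mem_ball_zero_iff.1 hy).le
    gcongr
  · simpa using (hasSum_coeff f 0).summable

/-- The chain rule at 0 together with |ψ'(0)| = 1 - |ψ(0)| ^ 2, the equality case of Schwarz–Pick.
-/
theorem norm_coeff_one_of_comp {η ζ : ℂ} {q : ℝ} {ψ : 𝔻 → 𝔻} (hψ : HasMultiplier η ζ q ψ)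
    (hη : ‖η‖ = 1) (hζ : ‖ζ‖ = 1) (hne : ζ ≠ η) (h0 : 0 < q) (h1 : q ≤ 1)
    {f h : WeightedDirichlet ν} (hfh : ∀ z, f z = h (ψ z)) :
    ‖coeff f 1‖ = ‖∑' n : ℕ, n * (ψ 0 : ℂ) ^ (n - 1) * coeff h n‖ * (1 - ‖(ψ 0 : ℂ)‖ ^ 2) := by
  have hE := HasMultiplier.denom_ne_zero hη hζ hne h0
  have hp := HasMultiplier.norm_pole_lt_one hη hζ hne h0 h1
  have hψ0 := hψ.norm_apply_zero hη hζ hne h0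
  have happ := hψ.apply_mul hη hζ hne h0
  set E := ζ - q * η with hEdef
  set a := HasMultiplier.pole η ζ q with ha
  set u := -(η * ζ * conj E) / E with hu
  have hu1 : ‖u‖ = 1 := by
    rw [hu, norm_div, norm_neg, norm_mul, norm_mul, RCLike.norm_conj, hη, hζ, one_mul, one_mul,
      div_self (norm_ne_zero_iff.2 hE)]
  let Ψ : ℂ → ℂ := fun z => u * ((z - conj a) / (1 - a * z))
  have hden : ∀ z : ℂ, ‖z‖ < 1 → 1 - a * z ≠ 0 := by
    intro z hz hz0
    have h2 : ‖a * z‖ = 1 := by rw [← sub_eq_zero.1 hz0, norm_one]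
    rw [norm_mul] at h2
    nlinarith [norm_nonneg a, norm_nonneg z]
  have hΨ : ∀ z : 𝔻, Ψ z = ψ z := by
    intro z
    have hz := hden z z.norm_lt_one
    have e := happ z
    simp only [Ψ, hu]
    rw [div_mul_div_comm, div_eq_iff (mul_ne_zero hE hz)]
    exact e.symm
  have hΨ0 : Ψ 0 = ψ 0 := by simpa using hΨ 0
  have hΨd : HasDerivAt Ψ (u * (1 - conj a * a)) 0 := by
    have := (((hasDerivAt_id (0 : ℂ)).sub_const (conj a)).div
      (((hasDerivAt_id (0 : ℂ)).const_mul a).const_sub 1) (hden 0 (by simp))).const_mul u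
    refine this.congr_deriv ?_
    simp
  have hd1 : HasDerivAt (extend f) (coeff f 1) 0 := by
    refine (hasDerivAt_extend f (by simp)).congr_deriv ?_
    rw [tsum_eq_single 1]
    · simp
    · intro n hn
      rcases Nat.lt_or_gt_of_ne hn with h | h
      · simp [Nat.lt_one_iff.1 h]
      · rw [zero_pow (by omega)]; ring
  have hd2 : HasDerivAt (extend h ∘ Ψ)
      ((∑' n : ℕ, n * (ψ 0 : ℂ) ^ (n - 1) * coeff h n) * (u * (1 - conj a * a))) 0 := by
    refine HasDerivAt.comp 0 ?_ hΨd
    rw [hΨ0]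
    exact hasDerivAt_extend h (ψ 0).norm_lt_one
  have heq : extend f =ᶠ[𝓝 0] extend h ∘ Ψ := by
    filter_upwards [Metric.ball_mem_nhds (0 : ℂ) one_pos] with z hz
    have hz' : ‖z‖ < 1 := by simpa using hz
    have e1 := extend_coe f (UnitDisc.mk z hz')
    have e2 := hΨ (UnitDisc.mk z hz')
    rw [UnitDisc.coe_mk] at e1 e2
    rw [e1, comp_apply, e2, extend_coe, hfh]
  have e := (hd1.congr_of_eventuallyEq heq.symm).unique hd2
  have e3 : (1 : ℂ) - conj a * a = ((1 - ‖a‖ ^ 2 : ℝ) : ℂ) := by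
    rw [conj_mul']; push_cast; rfl
  rw [e, norm_mul, norm_mul, hu1, one_mul, e3, norm_real, hψ0,
    Real.norm_of_nonneg (by nlinarith [norm_nonneg a])]

/-- In the ball about z, |f'(0)| ≥ 1 - Kε, while the chain rule gives |f'(0)| ≤ t + KεB with t = 1 -
|ψ^[n](0)| ^ 2. The derivative supplies the factor t, bounded away from 1, so the case |d| = 1, γ =
0 is covered too. -/
theorem exists_open_of_norm_le {η ζ : ℂ} {μ : ℝ} {ψ : 𝔻 → 𝔻} (hψ : HasMultiplier η ζ μ ψ)
    (hη : ‖η‖ = 1) (hζ : ‖ζ‖ = 1) (hne : ζ ≠ η) (h0 : 0 < μ) (h1 : μ < 1) {d : ℂ}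
    (hd : ‖d‖ ≤ μ ^ max 0 (1 / 2 - ν)) :
    ∃ U : Set (WeightedDirichlet ν), IsOpen U ∧ U.Nonempty ∧ ∀ n : ℕ, 0 < n → ∀ f ∈ U, ∀ h ∈ U,
      ¬ ∀ z, f z = d ^ n * h (ψ^[n] z) := by
  obtain ⟨K, hK, hKw⟩ := exists_deriv_functional ν
  set γ := max 0 (1 / 2 - ν) with hγ
  have hγ0 : 0 ≤ γ := le_max_left _ _
  have hδ : 0 < ‖ζ - η‖ := norm_pos_iff.2 (sub_ne_zero.2 hne)
  set B := (‖ζ - η‖ ^ 2 / 4) ^ (-γ) with hB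
  have hB0 : 0 < B := by positivity
  obtain ⟨M, hM⟩ := exists_shift ν
  set g := (M ^ 1) (cauchyKernel ν 0) with hg
  have hgc : coeff g = Pi.single 1 1 := coeff_shift_pow hM 1
  have h1μ : 0 < 1 - μ := by linarith
  -- Chosen so that Kε(1 + B) is half of the gap (1 - μ) ^ 2 / 4 between t and 1.
  set ε := (1 - μ) ^ 2 / (8 * (K * (1 + B))) with hε
  have hε0 : 0 < ε := by positivity
  have hεK : K * ε * (1 + B) = (1 - μ) ^ 2 / 8 := by
    rw [hε]; field_simp
  refine ⟨Metric.ball g ε, Metric.isOpen_ball, ⟨g, Metric.mem_ball_self hε0⟩, ?_⟩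
  intro n hn f hf h hh hfh
  -- derivative functionals at points of the disk
  have hbound : ∀ w : ℂ, ‖w‖ < 1 → ∀ e ∈ Metric.ball g ε,
      ‖(∑' n : ℕ, n * w ^ (n - 1) * coeff e n) - 1‖ ≤ K * (1 - ‖w‖ ^ 2) ^ (-(1 + γ)) * ε := by
    intro w hw e he
    obtain ⟨k, hk1, hk2⟩ := hKw w hw
    have e1 : inner ℂ k g = 1 := by
      refine (hk2 g).unique ?_
      have := hasSum_single (f := fun n : ℕ => (n * w ^ (n - 1)) * coeff g n) 1
        fun m hm => by simp [hgc, Pi.single_eq_of_ne hm]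
      simpa [hgc] using this
    rw [(hk2 e).tsum_eq, ← e1, ← inner_sub_right]
    refine (norm_inner_le_norm _ _).trans ?_
    have : ‖e - g‖ ≤ ε := by rw [← dist_eq_norm]; exact he.le
    have hpos : 0 < 1 - ‖w‖ ^ 2 := by nlinarith [norm_nonneg w]
    gcongr
  set q := μ ^ n with hq
  have hq0 : 0 < q := pow_pos h0 n
  have hq1 : q ≤ 1 := pow_le_one₀ h0.le h1.le
  -- Here n ≥ 1 is essential: for n = 0 there is no gap.
  have hqμ : q ≤ μ := pow_le_of_le_one h0.le h1.le hn.ne'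
  have hψn : HasMultiplier η ζ q ψ^[n] := hψ.iterate hζ n
  have hmain := norm_coeff_one_of_comp hψn hη hζ hne hq0 hq1 (f := f) (h := d ^ n • h)
    fun z => by rw [coe_smul]; exact hfh z
  have hψ0 := hψn.norm_apply_zero hη hζ hne hq0
  have hlow := HasMultiplier.le_one_sub_norm_pole_sq hη hζ hne hq0 hq1
  have hup := HasMultiplier.one_sub_norm_pole_sq_le hη hζ hne hq0 hq1
  rw [← hψ0] at hlow hup
  set w : ℂ := (ψ^[n] 0 : ℂ) with hw
  have hw1 : ‖w‖ < 1 := (ψ^[n] 0).norm_lt_one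
  set t := 1 - ‖w‖ ^ 2 with ht
  have ht0 : 0 < t := by nlinarith [norm_nonneg w]
  have ht1 : t ≤ 1 - (1 - μ) ^ 2 / 4 := hup.trans (by nlinarith)
  have hdn : ‖d‖ ^ n ≤ q ^ γ := by
    refine (pow_le_pow_left₀ (norm_nonneg d) hd n).trans_eq ?_
    rw [hq, ← Real.rpow_natCast, ← Real.rpow_natCast, ← Real.rpow_mul h0.le, ← Real.rpow_mul h0.le,
      mul_comm]
  have hqγ : q ^ γ ≤ 1 := Real.rpow_le_one hq0.le hq1 hγ0
  have hsmul : ∑' m : ℕ, m * w ^ (m - 1) * coeff (d ^ n • h) m =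
      d ^ n * ∑' m : ℕ, m * w ^ (m - 1) * coeff h m := by
    rw [← tsum_mul_left]
    refine tsum_congr fun m => ?_
    rw [coeff_smul, Pi.smul_apply, smul_eq_mul]
    ring
  have hfc : 1 - K * ε ≤ ‖coeff f 1‖ := by
    have e1 := hbound 0 (by simp) f hf
    have e2 : ∑' n : ℕ, (n : ℂ) * (0 : ℂ) ^ (n - 1) * coeff f n = coeff f 1 := by
      rw [tsum_eq_single 1]
      · simp
      · intro n hn
        rcases Nat.lt_or_gt_of_ne hn with h | h
        · simp [Nat.lt_one_iff.1 h]
        · rw [zero_pow (by omega)]; ring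
    rw [e2] at e1
    simp only [norm_zero, zero_pow two_ne_zero, sub_zero, Real.one_rpow, mul_one] at e1
    have e3 := norm_sub_norm_le (1 : ℂ) (coeff f 1)
    rw [norm_one, norm_sub_rev] at e3
    linarith
  have hD : ‖∑' m : ℕ, m * w ^ (m - 1) * coeff h m‖ ≤ 1 + K * t ^ (-(1 + γ)) * ε := by
    have e1 := hbound w hw1 h hh
    have e3 := norm_sub_norm_le (∑' m : ℕ, m * w ^ (m - 1) * coeff h m) 1
    rw [norm_one] at e3
    linarith
  -- The bound |d| ^ n ≤ q ^ γ exactly offsets the growth of the derivative functional, because t is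
  -- at least a constant times q.
  have htγ : q ^ γ * t ^ (-γ) ≤ B := by
    have e1 : t ^ (-γ) ≤ (q * (‖ζ - η‖ ^ 2 / 4)) ^ (-γ) :=
      Real.rpow_le_rpow_of_nonpos (by positivity) hlow (by linarith)
    rw [Real.mul_rpow hq0.le (by positivity)] at e1
    calc q ^ γ * t ^ (-γ) ≤ q ^ γ * (q ^ (-γ) * B) := by gcongr
      _ = (q ^ γ * q ^ (-γ)) * B := by ring
      _ = B := by rw [← Real.rpow_add hq0, add_neg_cancel, Real.rpow_zero, one_mul]
  have htt : t ^ (-(1 + γ)) * t = t ^ (-γ) := by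
    nth_rewrite 2 [← Real.rpow_one t]
    rw [← Real.rpow_add ht0]
    congr 1
    ring
  have hfinal : ‖coeff f 1‖ ≤ t + K * ε * B := by
    rw [hmain, hsmul, norm_mul, norm_pow]
    calc ‖d‖ ^ n * ‖∑' m : ℕ, m * w ^ (m - 1) * coeff h m‖ * t
        ≤ q ^ γ * (1 + K * t ^ (-(1 + γ)) * ε) * t := by gcongr
      _ = q ^ γ * t + K * ε * (q ^ γ * (t ^ (-(1 + γ)) * t)) := by ring
      _ ≤ 1 * t + K * ε * B := by
        rw [htt]
        gcongr
      _ = _ := by ring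
  linarith [pow_pos h1μ 2]

end WeightedDirichlet

/-! ### Assembly of the theorem. -/

open WeightedDirichlet in
theorem mainTheorem2 (ν : ℝ) (g : GL (Fin 2) ℂ) (φ : 𝔻 → 𝔻)
    (hφ : IsLinearFractionalAutomorphism g φ) (hhyp : IsHyperbolicLF g)
    (η : ℂ) (hη : IsAttractiveFixedPoint g (η : OnePoint ℂ)) :
    ∃ μ : ℝ, HasDerivAt (linearFractional g) (μ : ℂ) η ∧ 0 < μ ∧ μ < 1 ∧
      ∃ C : WeightedDirichlet ν →L[ℂ] WeightedDirichlet ν, IsCompositionOperator φ C ∧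
        ∀ c : ℂ, IsRecurrent (c • C) ↔
          ν < 1 / 2 ∧ μ ^ ((1 - 2 * ν) / 2) < ‖c‖ ∧ ‖c‖ < μ ^ ((2 * ν - 1) / 2) := by
  obtain ⟨ζ, μ, hη1, hζ1, hne, h0, h1, hmul, hderiv⟩ := exists_hasMultiplier g φ hφ hhyp η hη
  obtain ⟨ψ, hψl, hψr⟩ := bijective_iff_has_inverse.1 hφ.2
  have hmulψ : HasMultiplier ζ η μ ψ := hmul.symm hψr
  obtain ⟨σ, τ, r, hσ, hτ, hr0, hr1, hform⟩ := hmul.exists_normal_form hη1 hζ1 hne h0 h1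
  obtain ⟨C, hC⟩ := exists_isCompositionOperator ν hσ hτ hr0 hr1 hform
  obtain ⟨σ', τ', r', hσ', hτ', hr0', hr1', hform'⟩ :=
    hmulψ.exists_normal_form hζ1 hη1 hne.symm h0 h1
  obtain ⟨S, hS⟩ := exists_isCompositionOperator ν hσ' hτ' hr0' hr1' hform'
  refine ⟨μ, hderiv, h0, h1, C, hC, fun c => ⟨fun hrec => ?_, fun ⟨hν, hc1, hc2⟩ => ?_⟩⟩
  · have happ : ∀ (n : ℕ) (f : WeightedDirichlet ν) (z : 𝔻),
        ((c • C) ^ n) f z = c ^ n * f (φ^[n] z) := by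
      intro n f z
      rw [smul_pow, smul_apply, coe_smul, iterate_apply hC]
    have hlow : μ ^ max 0 (1 / 2 - ν) < ‖c‖ := by
      by_contra! hle
      obtain ⟨U, hU, hne', hno⟩ := exists_open_of_norm_le hmul hη1 hζ1 hne h0 h1 hle
      obtain ⟨n, hn, h, ⟨f, hf, hfh⟩, hh⟩ := hrec U hU hne'
      exact hno n hn h hh f hf fun z => by rw [← hfh, happ]
    have hc : c ≠ 0 := norm_pos_iff.1 (lt_trans (by positivity) hlow)
    -- A return of c C_φ, read backwards, is a return of c⁻¹ C_ψ, so the same obstruction applies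
    -- with η and ζ exchanged.
    have hup : ‖c‖ < (μ ^ max 0 (1 / 2 - ν))⁻¹ := by
      by_contra! hle
      have hle' : ‖c⁻¹‖ ≤ μ ^ max 0 (1 / 2 - ν) := by
        rw [norm_inv]
        exact inv_le_of_inv_le₀ (by positivity) hle
      obtain ⟨U, hU, hne', hno⟩ := exists_open_of_norm_le hmulψ hζ1 hη1 hne.symm h0 h1 hle'
      obtain ⟨n, hn, h, ⟨f, hf, hfh⟩, hh⟩ := hrec U hU hne'
      refine hno n hn f hf h hh fun z => ?_
      rw [← hfh, happ, LeftInverse.iterate hψr n z, inv_pow, inv_mul_cancel_left₀ (pow_ne_zero n hc)]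
    -- For ν ≥ 1/2 the exponent is 0 and the two bounds read 1 < |c| < 1.
    have hν : ν < 1 / 2 := by
      by_contra! hν
      rw [max_eq_left (by linarith), Real.rpow_zero] at hlow hup
      rw [inv_one] at hup
      linarith
    rw [max_eq_right (by linarith)] at hlow hup
    rw [← Real.rpow_neg h0.le] at hup
    refine ⟨hν, ?_, ?_⟩
    · convert! hlow using 2; ring
    · convert! hup using 2; ring
  · have hc : c ≠ 0 := norm_pos_iff.1 (lt_trans (by positivity) hc1)
    have hcn : 0 < ‖c‖ := norm_pos_iff.2 hc
    have e1 : μ ^ ((1 - 2 * ν) / 2) = μ ^ (1 / 2 - ν) := by congr 1; ring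
    have e2 : μ ^ ((2 * ν - 1) / 2) = (μ ^ (1 / 2 - ν))⁻¹ := by
      rw [← Real.rpow_neg h0.le]; congr 1; ring
    rw [e1] at hc1
    rw [e2] at hc2
    refine isRecurrent_of_dense (c • C) (c⁻¹ • S) (fun f => ?_)
      (dense_tendsto_zero hν.le hmul hη1 hζ1 hne h0 h1 hC ?_)
      (dense_tendsto_zero hν.le hmulψ hζ1 hη1 hne.symm h0 h1 hS ?_)
    · refine ext_apply fun z => ?_
      rw [smul_apply, smul_apply, coe_smul, hC, coe_smul, hS, hψl, mul_inv_cancel_left₀ hc]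
    · exact (lt_div_iff₀ (by positivity)).1 (by rwa [one_div])
    · rw [norm_inv, inv_mul_eq_div, div_lt_one hcn]
      exact hc1
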